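/- **Definitions.** Let $r\ge 1$ and $k\ge 3$. A word contains a pattern $p$ if it has a (not necessarily contiguous) subword order-isomorphic to $p$, equal letters corresponding to equal letters; otherwise it avoids $p$. The forbidden patterns are $1234$ and $1k(k-1)\dots 2$. A word on $[n]^r$ is a word with exactly $r$ copies of each of $1,\dots,n$. Let $w$ be a word. A *left-to-right minimum* (LTR min) of $w$ is a letter that does not exceed any earlier letter (so a further copy of the current minimum counts). Its *activated sequence* is the sequence of all later letters that are strictly larger. A letter value $c$ is *fixed* if some letter smaller than $c$ has occurred in $w$ that was itself preceded by a smaller letter. An LTR min $m$ is *superseded* if another LTR min arrives while the activated sequence of $m$ is still empty, and it is *deactivated* if every integer $c>m$ is fixed. The other LTR mins are *active*. Let $a\ge 0$, $L=[l_1,\dots,l_t]$ with $l_i\ge 0$, $M=[m_1,\dots,m_u]$ with entries in $[t]$, and $\mathcal S=[S_1,\dots,S_u]$ a list of lists with entries in $[t]$. A *partial word described by* $(a,M,\mathcal S,L)$ is a word $w$ such that: all letters of $w$ exceed $a$; $r$ copies of each of $1,\dots,a$ and $l_i$ copies of $a+i$ ($1\le i\le t$) remain to be placed, and for each letter the number of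 copies in $w$ plus the number remaining is at most $r$; the active LTR mins of $w$, in order, are $m_1+a,\dots,m_u+a$, with activated sequences $S_1+a,\dots,S_u+a$; $w$ avoids both patterns; appending any single remaining letter to $w$ does not create a $1234$; and for every LTR min $m$ that is deactivated and not superseded, its activated sequence, followed by all remaining letters exceeding $m$ in weakly decreasing order, avoids $(k-1)(k-2)\dots1$. A *completion* of $w$ is an arrangement $z$ of all the remaining letters such that $wz$ avoids both patterns. Let $A(r,k,a,M,\mathcal S,L)$ be the number of completions of a partial word described by $(a,M,\mathcal S,L)$ (and $0$ if there is none). Put $t=(2r+4)(k-2)+2$. An index $j\in[t]$ is *irrelevant* if $l_j=0$ and $j$ occurs neither in $M$ nor in any $S\in\mathcal S$. The tuple $(a,M,\mathcal S,L)$ is *canonical* if it describes some partial word, $|L|=t$, and either $a=0$ or no index is irrelevant. *Operations.* $\mathrm{Fix}(m,S,L)$ is $S$ followed by all available letters (with counts $L$) exceeding $m$ in decreasing order. $\mathrm{Reduce}(L,i)$ decreases the $i$th entry of $L$ by one. $\mathrm{Remove}(r,M,\mathcal S,L,i)$ increments all elements of $M$ and of the lists in $\mathcal S$ that are below $i$,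 deletes the $i$th entry of $L$ and prepends $r$ to $L$. *Choices.* $C(M,\mathcal S,L)$ is the set of those $i$ among the $2(k-2)+1$ largest indices with $l_i\neq0$ (all such indices if there are fewer) for which either $i\le m$ for all $m$ in $M$, or all of the following hold: $i$ does not exceed the smallest element of $S_1$ (no condition if $S_1=[\,]$), or $i$ is the largest index with $l_i\ne0$; for all $j$ with $m_j\ge i$, $\mathrm{Fix}(m_j,S_j,L)$ avoids $(k-1)\dots1$; for all $j$ with $m_j<i$, $S_j$ followed by $i$ avoids $(k-1)\dots1$. *Successors.* For $i\in C(M,\mathcal S,L)$ put $L'=\mathrm{Reduce}(L,i)$ and - if $i\le m$ for all $m$ in $M$ and $u\ge1$, $S_u=[\,]$: $M'=[m_1,\dots,m_{u-1},i]$, $\mathcal S'=[S_1,\dots,S_{u-1},[\,]]$; - if $i\le m$ for all $m$ in $M$ otherwise: $M'=[m_1,\dots,m_u,i]$, $\mathcal S'=[S_1,\dots,S_u,[\,]]$; - otherwise, with $h$ least such that $m_h<i$: $M'=[m_h,\dots,m_u]$, and $\mathcal S'$ is $[S_h,\dots,S_u]$ with $i$ appended to each list. Let $J$ be the set of irrelevant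 indices of $(M',\mathcal S',L')$; for $j\in J$ from smallest to largest replace $(M',\mathcal S',L')$ by $\mathrm{Remove}(r,M',\mathcal S',L',j)$. The result is the *successor* $(M^{(i)},\mathcal S^{(i)},L^{(i)})$. Let $a^{(i)}=a-|J|$; if this is negative, replace the first $|a^{(i)}|$ nonzero entries of $L^{(i)}$ by $0$ and then put $a^{(i)}=0$. **Theorem.** Let $r\ge1$, $k\ge3$ and $t=(2r+4)(k-2)+2$. 1. $A$ is well defined: any two partial words described by the same $(a,M,\mathcal S,L)$ have the same number of completions. 2. If $(a,M,\mathcal S,L)$ describes a partial word, then $|M|=|\mathcal S|\le 2r(k-2)+1$, $|S|\le 2r(k-2)$ for all $S\in\mathcal S$, and all $l_i\le r$. The set of all $(M,\mathcal S,L)$ for which $(a,M,\mathcal S,L)$ is canonical for some $a$ is finite. 3. For every canonical $(a,M,\mathcal S,L)$, if $ra+\sum_i l_i=0$ then $A(r,k,a,M,\mathcal S,L)=1$, and otherwise $$A(r,k,a,M,\mathcal S,L)=\sum_{i\in C(M,\mathcal S,L)}A\bigl(r,k,a^{(i)},M^{(i)},\mathcal S^{(i)},L^{(i)}\bigr).$$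 Each tuple $(a^{(i)},M^{(i)},\mathcal S^{(i)},L^{(i)})$ with $i\in C(M,\mathcal S,L)$ is again canonical, and its number of remaining letters is one less: $ra^{(i)}+\sum_j l^{(i)}_j=ra+\sum_j l_j-1$. 4. For every $n\ge0$, the number of words on $[n]^r$ avoiding $1234$ and $1k(k-1)\dots2$ is $A(r,k,\max(n-t,0),[\,],[\,],L)$, where $L$ has length $t$ and consists of $\max(t-n,0)$ zeros followed by entries $r$; this tuple is canonical. 5. These numbers satisfy a finite linear system of recurrences with constant coefficients. Let $\sigma_1,\dots,\sigma_d$ be the distinct triples $(M,\mathcal S,L)$ for which $(a,M,\mathcal S,L)$ is canonical for some $a>0$. Let $A_i(N)=A(r,k,a,\sigma_i)$ where $a\ge0$ is the integer for which $N$ letters remain (that is, $N=ra+\sum_j l_j$), and $A_i(N)=0$ if there is no such $a$. Let $c_{ij}$ be the number of choices at $\sigma_i$ whose successor is $\sigma_j$. Then $A_i(N+1)=\sum_{j=1}^d c_{ij}A_j(N)$ for all $i$ and all $N\ge 2rt$, and for some $i_0$ the number of words on $[n]^r$ avoiding both patterns is $A_{i_0}(rn)$ for all $n\ge t$. 6.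 The generating function $\sum_{n\ge0}W_n x^n$, where $W_n$ is the number of words on $[n]^r$ avoiding $1234$ and $1k(k-1)\dots2$, is rational: there are $P,Q\in\mathbb Q[x]$ with $Q(0)\ne0$ and $Q(x)\sum_{n\ge0}W_nx^n=P(x)$. -/

import Mathlib

namespace WordRecurrence

/-! Words are lists of positive integers; positions in a word are counted from `0`, and the letter
of `w` at position `p` is `w.getD p 0`. -/

/-- `w` contains the pattern `p`: some subword of `w` (letters in their order of occurrence, not
necessarily adjacent) has the length of `p` and is order-isomorphic to `p`, equal letters
corresponding to equal letters. -/
def Contains (w p : List ℕ) : Prop :=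
  ∃ v ∈ w.sublists, v.length = p.length ∧
    ∀ i < p.length, ∀ j < p.length,
      (v.getD i 0 < v.getD j 0 ↔ p.getD i 0 < p.getD j 0) ∧
      (v.getD i 0 > v.getD j 0 ↔ p.getD i 0 > p.getD j 0)

instance (w p : List ℕ) : Decidable (Contains w p) :=
  inferInstanceAs (Decidable (∃ v ∈ w.sublists, _))

/-- The pattern `1 k (k-1) … 2`. -/
def patternOneDesc (k : ℕ) : List ℕ := 1 :: (List.range' 2 (k - 1)).reverse

/-- The pattern `(k-1) (k-2) … 1`. -/
def patternDesc (k : ℕ) : List ℕ := (List.range' 1 (k - 1)).reverse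

/-- `w` avoids both `1234` and `1 k (k-1) … 2`. -/
def Avoids (k : ℕ) (w : List ℕ) : Prop :=
  ¬ Contains w [1, 2, 3, 4] ∧ ¬ Contains w (patternOneDesc k)

instance (k : ℕ) (w : List ℕ) : Decidable (Avoids k w) :=
  inferInstanceAs (Decidable (_ ∧ _))

/-- The number of words on `[n]^r` (`r` copies of each of `1, …, n`, nothing else) that avoid
`1234` and `1 k (k-1) … 2`. -/
noncomputable def numWords (r k n : ℕ) : ℕ :=
  {w : List ℕ | (∀ c, w.count c = if 1 ≤ c ∧ c ≤ n then r else 0) ∧ Avoids k w}.ncard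

/-! ### Left-to-right minima and activated sequences -/

/-- Position `p` of `w` holds a left-to-right minimum. A further copy of the current minimum is
counted as a left-to-right minimum too. -/
def IsLTRMin (w : List ℕ) (p : ℕ) : Prop :=
  p < w.length ∧ ∀ q < p, w.getD p 0 ≤ w.getD q 0

instance (w : List ℕ) (p : ℕ) : Decidable (IsLTRMin w p) :=
  inferInstanceAs (Decidable (_ ∧ _))

/-- The letters after position `p` that exceed the letter at position `p`. -/
def activatedSeq (w : List ℕ) (p : ℕ) : List ℕ :=
  (w.drop (p + 1)).filter (fun c => w.getD p 0 < c)

/-- The letter `c` is fixed: some letter smaller than `c` has occurred which was itself preceded by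
a smaller letter (so that, `1234` being forbidden, all later letters `≥ c` have to occur in weakly
decreasing order). -/
def IsFixed (w : List ℕ) (c : ℕ) : Prop :=
  ∃ q < w.length, w.getD q 0 < c ∧ ∃ q' < q, w.getD q' 0 < w.getD q 0

instance (w : List ℕ) (c : ℕ) : Decidable (IsFixed w c) :=
  inferInstanceAs (Decidable (∃ q < w.length, _))

/-- All letters exceeding the one at position `p` are fixed; as `IsFixed w` is monotone in the
letter, this is a condition on the next integer only. -/
def IsDeactivated (w : List ℕ) (p : ℕ) : Prop := IsFixed w (w.getD p 0 + 1)

instance (w : List ℕ) (p : ℕ) : Decidable (IsDeactivated w p) :=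
  inferInstanceAs (Decidable (IsFixed _ _))

/-- A later left-to-right minimum arrived while the activated sequence of `p` was still empty. -/
def IsSuperseded (w : List ℕ) (p : ℕ) : Prop :=
  ∃ q < w.length, p < q ∧ IsLTRMin w q ∧ ∀ q' < q, p < q' → w.getD q' 0 ≤ w.getD p 0

instance (w : List ℕ) (p : ℕ) : Decidable (IsSuperseded w p) :=
  inferInstanceAs (Decidable (∃ q < w.length, _))

/-- The positions of the left-to-right minima that are still taken into account. -/
def activePositions (w : List ℕ) : List ℕ :=
  (List.range w.length).filter
    (fun p => IsLTRMin w p ∧ ¬ IsSuperseded w p ∧ ¬ IsDeactivated w p)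

/-! ### The arguments of the counting function, other than `r`, `k` and `a` -/

/-- `minima` is `M`, `seqs` is `𝒮` and `counts` is `L`. -/
@[ext]
structure State where
  minima : List ℕ
  seqs : List (List ℕ)
  counts : List ℕ
deriving DecidableEq

/-- The entry `l_i` of `L = [l_1, …, l_t]`, and `0` for `i` outside `{1, …, t}`. -/
def entry (L : List ℕ) (i : ℕ) : ℕ := if i = 0 then 0 else L.getD (i - 1) 0

/-- The number of copies of the letter `c` that remain to be placed: `r` copies of `1, …, a` and
`l_i` copies of `a + i`. -/
def remaining (r a : ℕ) (L : List ℕ) (c : ℕ) : ℕ :=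
  if 1 ≤ c ∧ c ≤ a then r else entry L (c - a)

/-- The number of letters that remain to be placed. -/
def total (r a : ℕ) (σ : State) : ℕ := r * a + σ.counts.sum

/-- The sequence `s`, followed by all available letters (with counts `L`) that exceed `m`, in
weakly decreasing order. -/
def fix (m : ℕ) (s L : List ℕ) : List ℕ :=
  s ++ (List.range' (m + 1) (L.length - m)).reverse.flatMap (fun j => List.replicate (entry L j) j)

/-- `w` is a partial word described by `a`, `M`, `𝒮`, `L`: the letters `1, …, a` have not been used,
each letter has at most `r` copies in all, the left-to-right minima still taken into account and
their activated sequences are `M` and `𝒮` shifted by `a`, and `w` contains no forbidden pattern.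
Moreover no forbidden pattern has become inevitable in one of the two ways that `M`, `𝒮`, `L` need
not show: no remaining letter completes a `1234`, and no deactivated sequence, followed by the
remaining letters above its left-to-right minimum in their forced decreasing order, contains
`(k-1) … 1`. -/
structure IsPartialWord (r k a : ℕ) (σ : State) (w : List ℕ) : Prop where
  unused : ∀ c ∈ w, a < c
  count_le : ∀ c, w.count c + remaining r a σ.counts c ≤ r
  minima_mem : ∀ m ∈ σ.minima, 1 ≤ m ∧ m ≤ σ.counts.length
  seqs_mem : ∀ s ∈ σ.seqs, ∀ c ∈ s, 1 ≤ c ∧ c ≤ σ.counts.length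
  minima_eq : (activePositions w).map (fun p => w.getD p 0) = σ.minima.map (fun m => a + m)
  seqs_eq : (activePositions w).map (activatedSeq w) = σ.seqs.map (List.map (fun c => a + c))
  avoids : Avoids k w
  not_inevitable : ∀ c, 0 < remaining r a σ.counts c → ¬ Contains (w ++ [c]) [1, 2, 3, 4]
  deactivated : ∀ p, IsLTRMin w p → ¬ IsSuperseded w p → IsDeactivated w p →
    ¬ Contains (fix (w.getD p 0) (activatedSeq w p) (List.replicate a r ++ σ.counts)) (patternDesc k)

/-- The ways to complete `w` with the remaining letters without creating a forbidden pattern. -/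
def completions (r k a : ℕ) (L : List ℕ) (w : List ℕ) : Set (List ℕ) :=
  {z | (∀ c, z.count c = remaining r a L c) ∧ Avoids k (w ++ z)}

open Classical in
/-- `A(r, k, a, M, 𝒮, L)`: the number of ways to complete a partial word described by
`a, M, 𝒮, L` (`0` if there is no such word). -/
noncomputable def A (r k a : ℕ) (σ : State) : ℕ :=
  if h : ∃ w, IsPartialWord r k a σ w then (completions r k a σ.counts h.choose).ncard else 0

/-! ### The recurrence -/

/-- The length `t` of `L` in the canonical descriptions. -/
def tlen (r k : ℕ) : ℕ := (2 * r + 4) * (k - 2) + 2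

/-- `L` with its `i`-th entry decreased by one. -/
def reduce (L : List ℕ) (i : ℕ) : List ℕ := L.modify (i - 1) (fun l => l - 1)

/-- Increment by one all elements of `M` and `𝒮` below `i`, delete the `i`-th entry of `L` and
prepend `r` to `L`. -/
def remove (r : ℕ) (σ : State) (i : ℕ) : State where
  minima := σ.minima.map (fun c => if c < i then c + 1 else c)
  seqs := σ.seqs.map (List.map (fun c => if c < i then c + 1 else c))
  counts := r :: σ.counts.eraseIdx (i - 1)

/-- The `j ∈ {1, …, t}`, in increasing order, with `l_j = 0` that appear neither in `M` nor in `𝒮`. -/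
def irrelevant (σ : State) : List ℕ :=
  (List.range' 1 σ.counts.length).filter
    (fun j => entry σ.counts j = 0 ∧ j ∉ σ.minima ∧ ∀ s ∈ σ.seqs, j ∉ s)

/-- The updated lists after the letter `i` has been added, before irrelevant letters are removed.
If `i` does not exceed the last element of `M`, it is a new left-to-right minimum, and it supersedes
the last one if that one has an empty activated sequence. Otherwise, with `h` the least index such
that `m_h < i`, the first `h - 1` minima are deactivated, and `i` joins the other sequences. -/
def addLetter (σ : State) (i : ℕ) : State :=
  if ∀ m ∈ σ.minima, i ≤ m then
    if σ.seqs.getLast? = some [] then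
      ⟨σ.minima.dropLast ++ [i], σ.seqs.dropLast ++ [[]], reduce σ.counts i⟩
    else
      ⟨σ.minima ++ [i], σ.seqs ++ [[]], reduce σ.counts i⟩
  else
    let kept := (σ.minima.zip σ.seqs).dropWhile (fun x => i ≤ x.1)
    ⟨kept.map Prod.fst, kept.map (fun x => x.2 ++ [i]), reduce σ.counts i⟩

/-- `|J|`, the number of letters that become irrelevant when `i` is added. -/
def lost (σ : State) (i : ℕ) : ℕ := (irrelevant (addLetter σ i)).length

/-- The lists `M', 𝒮', L'` after `i` has been added and the irrelevant letters have been removed,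
from the smallest to the largest. -/
def successor (r : ℕ) (σ : State) (i : ℕ) : State :=
  (irrelevant (addLetter σ i)).foldl (remove r) (addLetter σ i)

/-- Replace the first `d` nonzero entries of a list by `0`. -/
def clearFirst : ℕ → List ℕ → List ℕ
  | 0, L => L
  | _ + 1, [] => []
  | d + 1, 0 :: L => 0 :: clearFirst (d + 1) L
  | d + 1, (_ + 1) :: L => 0 :: clearFirst d L

/-- The lists with which `A` is called when `i` is added at the value `a`; the new value of `a` is
`a - lost σ i`. Were this negative, it is replaced by `0`, and as many nonzero entries of `L'` as it
was below `0`, counted from the left, are replaced by `0`. -/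
def next (r a : ℕ) (σ : State) (i : ℕ) : State :=
  { successor r σ i with counts := clearFirst (lost σ i - a) (successor r σ i).counts }

/-- The letter `i` may be added as far as `M`, `𝒮`, `L` show. There is no condition if it is a new
left-to-right minimum. Otherwise it must not exceed the smallest element of the first activated
sequence, unless it is the largest remaining letter; a sequence deactivated by `i` must not lead to
a forbidden pattern; and `i` must not complete a forbidden pattern with a sequence that it joins. -/
def Admissible (k : ℕ) (σ : State) (i : ℕ) : Prop :=
  (∀ m ∈ σ.minima, i ≤ m) ∨
    (((∀ c ∈ σ.seqs.headD [], i ≤ c) ∨ ∀ j ∈ Finset.Icc 1 σ.counts.length,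
        entry σ.counts j ≠ 0 → j ≤ i) ∧
      ∀ x ∈ σ.minima.zip σ.seqs,
        (i ≤ x.1 → ¬ Contains (fix x.1 x.2 σ.counts) (patternDesc k)) ∧
        (x.1 < i → ¬ Contains (x.2 ++ [i]) (patternDesc k)))

instance (k : ℕ) (σ : State) (i : ℕ) : Decidable (Admissible k σ i) :=
  inferInstanceAs (Decidable (_ ∨ _))

/-- The admissible letters among the `2(k-2)+1` largest `i` with `l_i ≠ 0`. -/
def choices (k : ℕ) (σ : State) : Finset ℕ :=
  (Finset.Icc 1 σ.counts.length).filter (fun i => entry σ.counts i ≠ 0 ∧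
    ((Finset.Icc (i + 1) σ.counts.length).filter (fun j => entry σ.counts j ≠ 0)).card ≤ 2 * (k - 2)
    ∧ Admissible k σ i)

/-- `(a, M, 𝒮, L)` is a canonical description of a partial word: `L` has length `t` and, unless all
remaining letters are listed in `L`, no irrelevant letter is listed. -/
def IsCanonical (r k a : ℕ) (σ : State) : Prop :=
  σ.counts.length = tlen r k ∧ (0 < a → irrelevant σ = []) ∧ ∃ w, IsPartialWord r k a σ w

/-- `A` as a function of the number `N` of letters that remain to be placed, the lists `M`, `𝒮`, `L`
being given: `a` is determined by `N = r a + l_1 + ⋯ + l_t`, and the value is `0` if there is no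
such `a`. -/
noncomputable def byTotal (r k : ℕ) (σ : State) (N : ℕ) : ℕ :=
  if σ.counts.sum ≤ N ∧ r ∣ N - σ.counts.sum then A r k ((N - σ.counts.sum) / r) σ else 0

/-- The state of the empty word on `[n]^r`; if `n < t` then `L` is filled up with letters that have
no copies. -/
def initial (r k n : ℕ) : State :=
  ⟨[], [], List.replicate (tlen r k - n) 0 ++ List.replicate (tlen r k - (tlen r k - n)) r⟩

end WordRecurrence

open WordRecurrence

/-!
# Words avoiding `1234` and `1 k (k-1) … 2`

A word avoids both patterns if and only if, for each of its letters, the later larger letters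
avoid `123` and `(k-1) … 1` (`avoids_iff`); it suffices to look at the left-to-right minima that
are not superseded (`allAbove_append`). For a partial word `w`, continued by an arrangement `z` of
the remaining letters, these conditions concern `z` alone and, for each left-to-right minimum `m`
of `w`, its activated sequence followed by the letters of `z` above `m`. If `m` is deactivated,
then some active sequence contains a letter that is at most `m` (`IsFixed.exists_activeList`), so
that the letters of `z` above `m` have to decrease weakly; they then form the word that occurs in
the definition of a partial word, where they do no harm. Hence the completions depend on the
active minima and their activated sequences only (`IsPartialWord.completions_eq`).

How the list of active minima and sequences changes under appending a letter is determined by the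
list itself (`activeList_snoc`). Therefore it always has the same shape (`Nested`): the minima
decrease weakly, the sequences are proper suffixes of their predecessors, and their letters exceed
all the minima. Conversely, a list of this shape is realized by a word without deactivated minima
(`Nested.exists_word`). Thus a state describes a partial word if and only if it satisfies
conditions in which neither the word nor `a` occurs (`exists_isPartialWord_iff`). In a sequence
that avoids `123` and `(k-1) … 1` there are at most `2(k-2)` distinct letters, as it is the union
of two decreasing sequences (`exists_two_decreasing`); this bounds the sequences, the minima,
whose sequences have distinct lengths, and the number of states.

For the recurrence, completions are sorted by their first letter. The remaining letters above it
avoid `123` and `(k-1) … 1`, so that it is among the `2(k-2)+1` largest remaining letters, and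
since no irrelevant letter is listed, at least that many listed letters remain: the first letter
is a choice (`exists_choice_of_cons_mem_comp`). An admissible letter leads to the completions of
the extended word (`cons_mem_comp_iff`), and irrelevant letters are removed by an order-preserving
relabelling, which keeps the number of completions (`removeAll_spec`).

If many letters remain, then `a` stays positive, and the recurrence becomes a linear system with
constant coefficients (`exists_linear_system`). By the Cayley–Hamilton theorem, applied to the
`r`-th power of its matrix, the numbers of words satisfy a linear recurrence from some point on,
so that their generating function is rational (`exists_rational_of_linear_system`).
-/

namespace WordRecurrence

open List

/-! ### Patterns as monotone subwords -/

/-- `v` has a strictly increasing subword of length `n`. -/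
def IncSub (n : ℕ) (v : List ℕ) : Prop := ∃ u, u <+ v ∧ u.length = n ∧ u.Pairwise (· < ·)

/-- `v` has a strictly decreasing subword of length `n`. -/
def DecSub (n : ℕ) (v : List ℕ) : Prop := ∃ u, u <+ v ∧ u.length = n ∧ u.Pairwise (· > ·)

/-- What is asked of the letters that follow, and exceed, a given letter: they avoid `123` and
`(k-1) … 1`. -/
def Good (k : ℕ) (v : List ℕ) : Prop := ¬ IncSub 3 v ∧ ¬ DecSub (k - 1) v

/-- Each subword of `w` that follows a letter of `w` and lies above it has the property `G`. -/
def AllAbove (G : List ℕ → Prop) (w : List ℕ) : Prop :=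
  ∀ x u, x :: u <+ w → (∀ y ∈ u, x < y) → G u

theorem IncSub.mono {n : ℕ} {u v : List ℕ} (h : IncSub n u) (huv : u <+ v) : IncSub n v := by
  obtain ⟨t, ht, h2⟩ := h
  exact ⟨t, ht.trans huv, h2⟩

theorem DecSub.mono {n : ℕ} {u v : List ℕ} (h : DecSub n u) (huv : u <+ v) : DecSub n v := by
  obtain ⟨t, ht, h2⟩ := h
  exact ⟨t, ht.trans huv, h2⟩

theorem DecSub.of_le {m n : ℕ} {v : List ℕ} (h : DecSub n v) (hmn : m ≤ n) : DecSub m v := by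
  obtain ⟨t, ht, h1, h2⟩ := h
  exact ⟨t.take m, (take_sublist _ _).trans ht, by simp [h1, hmn], h2.sublist (take_sublist _ _)⟩

theorem Good.mono {k : ℕ} {u v : List ℕ} (h : Good k v) (huv : u <+ v) : Good k u :=
  ⟨fun h' => h.1 (h'.mono huv), fun h' => h.2 (h'.mono huv)⟩

theorem getD_lt_getD_iff_of_increasing {v : List ℕ} (hv : v.Pairwise (· < ·)) {i j : ℕ}
    (hi : i < v.length) (hj : j < v.length) : v.getD i 0 < v.getD j 0 ↔ i < j := by
  rw [pairwise_iff_getElem] at hv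
  rw [getD_eq_getElem _ _ hi, getD_eq_getElem _ _ hj]
  rcases lt_trichotomy i j with h | h | h
  · simp [h, hv i j hi hj h]
  · subst h; simp
  · have := hv j i hj hi h
    constructor <;> intro <;> omega

theorem getD_lt_getD_iff_of_decreasing {v : List ℕ} (hv : v.Pairwise (· > ·)) {i j : ℕ}
    (hi : i < v.length) (hj : j < v.length) : v.getD i 0 < v.getD j 0 ↔ j < i := by
  rw [pairwise_iff_getElem] at hv
  rw [getD_eq_getElem _ _ hi, getD_eq_getElem _ _ hj]
  rcases lt_trichotomy i j with h | h | h
  · have := hv i j hi hj h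
    constructor <;> intro <;> omega
  · subst h; simp
  · simp [h, hv j i hj hi h]

theorem contains_iff_incSub {p : List ℕ} (hp : p.Pairwise (· < ·)) (w : List ℕ) :
    Contains w p ↔ IncSub p.length w := by
  constructor
  · rintro ⟨v, hv, hl, h⟩
    refine ⟨v, mem_sublists.1 hv, hl, ?_⟩
    rw [pairwise_iff_getElem]
    intro i j hi hj hij
    have := ((h i (hl ▸ hi) j (hl ▸ hj)).1).2
      ((getD_lt_getD_iff_of_increasing hp (hl ▸ hi) (hl ▸ hj)).2 hij)
    rwa [getD_eq_getElem _ _ hi, getD_eq_getElem _ _ hj] at this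
  · rintro ⟨v, hv, hl, h⟩
    refine ⟨v, mem_sublists.2 hv, hl, fun i hi j hj => ?_⟩
    have hi' := hl.symm ▸ hi
    have hj' := hl.symm ▸ hj
    simp only [gt_iff_lt, getD_lt_getD_iff_of_increasing hp hi hj,
      getD_lt_getD_iff_of_increasing hp hj hi, getD_lt_getD_iff_of_increasing h hi' hj',
      getD_lt_getD_iff_of_increasing h hj' hi', and_self]

theorem contains_iff_decSub {p : List ℕ} (hp : p.Pairwise (· > ·)) (w : List ℕ) :
    Contains w p ↔ DecSub p.length w := by
  constructor
  · rintro ⟨v, hv, hl, h⟩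
    refine ⟨v, mem_sublists.1 hv, hl, ?_⟩
    rw [pairwise_iff_getElem]
    intro i j hi hj hij
    have := ((h j (hl ▸ hj) i (hl ▸ hi)).1).2
      ((getD_lt_getD_iff_of_decreasing hp (hl ▸ hj) (hl ▸ hi)).2 hij)
    rwa [getD_eq_getElem _ _ hi, getD_eq_getElem _ _ hj] at this
  · rintro ⟨v, hv, hl, h⟩
    refine ⟨v, mem_sublists.2 hv, hl, fun i hi j hj => ?_⟩
    have hi' := hl.symm ▸ hi
    have hj' := hl.symm ▸ hj
    simp only [gt_iff_lt, getD_lt_getD_iff_of_decreasing hp hi hj,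
      getD_lt_getD_iff_of_decreasing hp hj hi, getD_lt_getD_iff_of_decreasing h hi' hj',
      getD_lt_getD_iff_of_decreasing h hj' hi', and_self]

theorem reverse_range'_pairwise (a n : ℕ) : (range' a n).reverse.Pairwise (· > ·) := by
  rw [pairwise_reverse]
  exact pairwise_lt_range'

theorem contains_patternDesc_iff (k : ℕ) (w : List ℕ) :
    Contains w (patternDesc k) ↔ DecSub (k - 1) w := by
  rw [patternDesc, contains_iff_decSub (reverse_range'_pairwise _ _)]
  simp

theorem contains_1234_iff (w : List ℕ) :
    Contains w [1, 2, 3, 4] ↔ ¬ AllAbove (fun v => ¬ IncSub 3 v) w := by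
  rw [contains_iff_incSub (by decide) w]
  simp only [AllAbove, not_forall, not_not]
  constructor
  · rintro ⟨v, hv, hl, h⟩
    match v with
    | x :: u =>
      rw [pairwise_cons] at h
      exact ⟨x, u, hv, h.1, u, Sublist.refl _, by simpa using hl, h.2⟩
  · rintro ⟨x, u, hu, hx, v, hv, hl, h⟩
    exact ⟨x :: v, (hv.cons_cons x).trans hu, by simp [hl],
      pairwise_cons.2 ⟨fun y hy => hx y (hv.subset hy), h⟩⟩

theorem contains_patternOneDesc_iff (k : ℕ) (w : List ℕ) :
    Contains w (patternOneDesc k) ↔ ¬ AllAbove (fun v => ¬ DecSub (k - 1) v) w := by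
  have hp := reverse_range'_pairwise 2 (k - 1)
  have hlt : ∀ i < (range' 2 (k - 1)).reverse.length, 1 < (range' 2 (k - 1)).reverse.getD i 0 := by
    intro i hi
    rw [getD_eq_getElem _ _ hi]
    have := getElem_mem hi
    simp only [mem_reverse, mem_range'_1] at this
    omega
  simp only [AllAbove, not_forall, not_not]
  constructor
  · rintro ⟨v, hv, hl, h⟩
    match v with
    | x :: u =>
      simp only [patternOneDesc, length_cons, Nat.add_right_cancel_iff] at hl h
      have key : ∀ i < u.length, x < u.getD i 0 := by
        intro i hi
        have := (h 0 (by omega) (i + 1) (by omega)).1.2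
        simp only [getD_cons_zero, getD_cons_succ] at this
        exact this (hlt i (hl ▸ hi))
      refine ⟨x, u, mem_sublists.1 hv, ?_, u, Sublist.refl _, by simpa using hl, ?_⟩
      · intro y hy
        obtain ⟨i, hi, rfl⟩ := getElem_of_mem hy
        rw [← getD_eq_getElem _ 0 hi]
        exact key i hi
      · rw [pairwise_iff_getElem]
        intro i j hi hj hij
        have := (h (j + 1) (by omega) (i + 1) (by omega)).1
        simp only [getD_cons_succ] at this
        rw [getD_eq_getElem _ _ hi, getD_eq_getElem _ _ hj,
          getD_lt_getD_iff_of_decreasing hp (by omega) (by omega)] at this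
        exact this.2 hij
  · rintro ⟨x, u, hu, hx, v, hv, hl, h⟩
    have hl' : v.length = (range' 2 (k - 1)).reverse.length := by simpa using hl
    have key : ∀ i < v.length, x < v.getD i 0 := by
      intro i hi
      rw [getD_eq_getElem _ _ hi]
      exact hx _ (hv.subset (getElem_mem hi))
    refine ⟨x :: v, mem_sublists.2 ((hv.cons_cons x).trans hu), by simp [patternOneDesc, hl],
      fun i hi j hj => ?_⟩
    simp only [patternOneDesc, length_cons] at hi hj
    rcases i with _ | i <;> rcases j with _ | j <;>
      simp only [patternOneDesc, getD_cons_zero, getD_cons_succ, gt_iff_lt, lt_irrefl, and_self]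
    · have h1 := key j (by omega)
      have h2 := hlt j (by omega)
      constructor <;> constructor <;> intro <;> omega
    · have h1 := key i (by omega)
      have h2 := hlt i (by omega)
      constructor <;> constructor <;> intro <;> omega
    · rw [getD_lt_getD_iff_of_decreasing hp (by omega) (by omega),
        getD_lt_getD_iff_of_decreasing hp (by omega) (by omega),
        getD_lt_getD_iff_of_decreasing h (by omega) (by omega),
        getD_lt_getD_iff_of_decreasing h (by omega) (by omega)]
      simp

/-- Both patterns start with their least letter, and the rest is `123` or `(k-1) … 1` up to order
isomorphism. -/
theorem avoids_iff (k : ℕ) (w : List ℕ) : Avoids k w ↔ AllAbove (Good k) w := by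
  rw [Avoids, contains_1234_iff, contains_patternOneDesc_iff, not_not, not_not]
  exact ⟨fun h x u hu hx => ⟨h.1 x u hu hx, h.2 x u hu hx⟩,
    fun h => ⟨fun x u hu hx => (h x u hu hx).1, fun x u hu hx => (h x u hu hx).2⟩⟩

theorem AllAbove.mono {G : List ℕ → Prop} {u v : List ℕ} (h : AllAbove G v) (huv : u <+ v) :
    AllAbove G u := fun x t ht hx => h x t (ht.trans huv) hx

theorem allAbove_cons {G : List ℕ → Prop} (hG : ∀ u v, u <+ v → G v → G u) (x : ℕ) (w : List ℕ) :
    AllAbove G (x :: w) ↔ G (w.filter (fun y => x < y)) ∧ AllAbove G w := by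
  constructor
  · intro h
    exact ⟨h x _ (filter_sublist.cons_cons x) (by simp), h.mono (sublist_cons_self _ _)⟩
  · rintro ⟨h1, h2⟩ y u hu hy
    rw [cons_sublist_cons'] at hu
    rcases hu with hu | ⟨rfl, hu⟩
    · exact h2 y u hu hy
    · refine hG _ _ ?_ h1
      have := hu.filter (fun z => decide (y < z))
      rwa [filter_eq_self.2 (by simpa using hy)] at this

theorem good_closed (k : ℕ) (u v : List ℕ) (h : u <+ v) (hv : Good k v) : Good k u := hv.mono h

theorem not_incSub_closed (n : ℕ) (u v : List ℕ) (h : u <+ v) (hv : ¬ IncSub n v) : ¬ IncSub n u :=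
  fun h' => hv (h'.mono h)

theorem avoids_cons (k x : ℕ) (w : List ℕ) :
    Avoids k (x :: w) ↔ Good k (w.filter (fun y => x < y)) ∧ Avoids k w := by
  rw [avoids_iff, avoids_iff, allAbove_cons (good_closed k)]

/-! ### Relabelling -/

theorem incSub_map {g : ℕ → ℕ} (hg : StrictMono g) (n : ℕ) (v : List ℕ) :
    IncSub n (v.map g) ↔ IncSub n v := by
  constructor
  · rintro ⟨u, hu, hl, h⟩
    obtain ⟨u, hu', rfl⟩ := sublist_map_iff.1 hu
    rw [pairwise_map] at h
    exact ⟨u, hu', by simpa using hl, h.imp (fun h => hg.lt_iff_lt.1 h)⟩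
  · rintro ⟨u, hu, hl, h⟩
    exact ⟨u.map g, hu.map g, by simpa using hl, pairwise_map.2 (h.imp (fun h => hg h))⟩

theorem decSub_map {g : ℕ → ℕ} (hg : StrictMono g) (n : ℕ) (v : List ℕ) :
    DecSub n (v.map g) ↔ DecSub n v := by
  constructor
  · rintro ⟨u, hu, hl, h⟩
    obtain ⟨u, hu', rfl⟩ := sublist_map_iff.1 hu
    rw [pairwise_map] at h
    exact ⟨u, hu', by simpa using hl, h.imp (fun h => hg.lt_iff_lt.1 h)⟩
  · rintro ⟨u, hu, hl, h⟩
    exact ⟨u.map g, hu.map g, by simpa using hl, pairwise_map.2 (h.imp (fun h => hg h))⟩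

theorem good_map {g : ℕ → ℕ} (hg : StrictMono g) (k : ℕ) (v : List ℕ) :
    Good k (v.map g) ↔ Good k v := by
  rw [Good, Good, incSub_map hg, decSub_map hg]

theorem filter_gt_map {g : ℕ → ℕ} (hg : StrictMono g) (m : ℕ) (v : List ℕ) :
    (v.map g).filter (fun c => g m < c) = (v.filter (fun c => m < c)).map g := by
  rw [filter_map]
  congr 1
  apply filter_congr
  intro x _
  simp [hg.lt_iff_lt]

theorem avoids_map {g : ℕ → ℕ} (hg : StrictMono g) (k : ℕ) (v : List ℕ) :
    Avoids k (v.map g) ↔ Avoids k v := by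
  induction v with
  | nil => rfl
  | cons x v ih => rw [map_cons, avoids_cons, avoids_cons, ih, filter_gt_map hg, good_map hg]

/-! ### Words without a strictly increasing subword of length three -/

/-- The letters followed by a larger one decrease, and so do the others. -/
theorem exists_two_decreasing (v : List ℕ) (hv : v.Nodup) (h : ¬ IncSub 3 v) :
    ∃ d₁ d₂ : List ℕ, d₁ <+ v ∧ d₂ <+ v ∧ d₁.Pairwise (· > ·) ∧ d₂.Pairwise (· > ·) ∧
      d₁.length + d₂.length = v.length ∧ ∀ x ∈ d₂, ∃ y, x < y ∧ [x, y] <+ v := by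
  induction v with
  | nil => exact ⟨[], [], by simp⟩
  | cons x v ih =>
    rw [nodup_cons] at hv
    obtain ⟨d₁, d₂, h1, h2, h3, h4, h5, h6⟩ :=
      ih hv.2 (fun h' => h (h'.mono (sublist_cons_self _ _)))
    have hs := sublist_cons_self x v
    by_cases hx : ∃ y ∈ v, x < y
    · obtain ⟨y, hy, hxy⟩ := hx
      refine ⟨d₁, x :: d₂, h1.trans hs, h2.cons_cons x, h3, pairwise_cons.2 ⟨?_, h4⟩,
        by simp only [length_cons]; omega, ?_⟩
      · intro z hz
        by_contra hzx
        obtain ⟨z', hz', hzz'⟩ := h6 z hz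
        have hne : x ≠ z := fun e => hv.1 (e ▸ h2.subset hz)
        exact h ⟨[x, z, z'], hzz'.cons_cons x, rfl, by simp; omega⟩
      · intro z hz
        rcases mem_cons.1 hz with rfl | hz
        · exact ⟨y, hxy, (singleton_sublist.2 hy).cons_cons z⟩
        · obtain ⟨z', hz', hzz'⟩ := h6 z hz
          exact ⟨z', hz', hzz'.trans hs⟩
    · push Not at hx
      refine ⟨x :: d₁, d₂, h1.cons_cons x, h2.trans hs, pairwise_cons.2 ⟨?_, h3⟩, h4,
        by simp only [length_cons]; omega, ?_⟩
      · intro z hz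
        have hz := h1.subset hz
        exact lt_of_le_of_ne (hx z hz) (fun e => hv.1 (e ▸ hz))
      · intro z hz
        obtain ⟨z', hz', hzz'⟩ := h6 z hz
        exact ⟨z', hz', hzz'.trans hs⟩

/-- The case of the Erdős–Szekeres theorem that bounds the number of distinct letters. -/
theorem Good.length_le_of_nodup {k : ℕ} (hk : 3 ≤ k) {v : List ℕ} (h : Good k v) (hv : v.Nodup) :
    v.length ≤ 2 * (k - 2) := by
  obtain ⟨d₁, d₂, h1, h2, h3, h4, h5, -⟩ := exists_two_decreasing v hv h.1
  have key : ∀ d : List ℕ, d <+ v → d.Pairwise (· > ·) → d.length ≤ k - 2 := by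
    intro d hd hp
    by_contra hlt
    exact h.2 (DecSub.of_le ⟨d, hd, rfl, hp⟩ (by omega))
  have := key d₁ h1 h3
  have := key d₂ h2 h4
  omega

theorem Good.card_toFinset_le {k : ℕ} (hk : 3 ≤ k) {v : List ℕ} (h : Good k v) :
    v.toFinset.card ≤ 2 * (k - 2) := by
  rw [card_toFinset]
  exact (h.mono (dedup_sublist v)).length_le_of_nodup hk (nodup_dedup v)

theorem length_le_of_count_le {r : ℕ} (v : List ℕ) (h : ∀ c, v.count c ≤ r) :
    v.length ≤ v.toFinset.card * r := by
  have : v.length = ∑ c ∈ v.toFinset, v.count c := by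
    simp
  rw [this]
  exact (Finset.sum_le_card_nsmul _ _ r (fun c _ => h c)).trans (by simp)

/-! ### Active minima under appending a letter -/

/-- The active left-to-right minima of `w` in order of occurrence, each with its activated
sequence. -/
def activeList (w : List ℕ) : List (ℕ × List ℕ) :=
  (activePositions w).map (fun p => (w.getD p 0, activatedSeq w p))

/-- The effect on the list of active minima and activated sequences of appending the letter `c`. -/
def appendLetter (P : List (ℕ × List ℕ)) (c : ℕ) : List (ℕ × List ℕ) :=
  if ∀ x ∈ P, c ≤ x.1 then P.filter (fun x => x.2 ≠ []) ++ [(c, [])]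
  else (P.filter (fun x => x.1 < c)).map (fun x => (x.1, x.2 ++ [c]))

/-- The shape of every list of active minima: the minima decrease weakly, each sequence is a proper
suffix of the previous ones, and the letters of the sequences exceed all the minima. -/
structure Nested (P : List (ℕ × List ℕ)) : Prop where
  chain : P.Pairwise (fun x y => y.1 ≤ x.1 ∧ y.2 <:+ x.2 ∧ y.2 ≠ x.2)
  above : ∀ x ∈ P, ∀ c ∈ x.2, ∀ y ∈ P, y.1 < c

theorem getD_snoc_lt {w : List ℕ} {c p : ℕ} (hp : p < w.length) :
    (w ++ [c]).getD p 0 = w.getD p 0 := getD_append _ _ _ _ hp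

theorem getD_snoc_length (w : List ℕ) (c : ℕ) : (w ++ [c]).getD w.length 0 = c := by
  simp

theorem getD_mem {w : List ℕ} {p : ℕ} (hp : p < w.length) : w.getD p 0 ∈ w := by
  rw [getD_eq_getElem _ _ hp]; exact getElem_mem hp

theorem exists_getD_of_mem {w : List ℕ} {x : ℕ} (hx : x ∈ w) : ∃ p < w.length, w.getD p 0 = x := by
  obtain ⟨i, hi, rfl⟩ := getElem_of_mem hx
  exact ⟨i, hi, getD_eq_getElem _ _ hi⟩

theorem isLTRMin_snoc_lt {w : List ℕ} {c p : ℕ} (hp : p < w.length) :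
    IsLTRMin (w ++ [c]) p ↔ IsLTRMin w p := by
  unfold IsLTRMin
  rw [getD_snoc_lt hp]
  refine and_congr (by simp; omega) (forall₂_congr fun q hq => ?_)
  rw [getD_snoc_lt (hq.trans hp)]

theorem isLTRMin_snoc_length (w : List ℕ) (c : ℕ) :
    IsLTRMin (w ++ [c]) w.length ↔ ∀ x ∈ w, c ≤ x := by
  unfold IsLTRMin
  rw [getD_snoc_length]
  constructor
  · rintro ⟨-, h⟩ x hx
    obtain ⟨p, hp, rfl⟩ := exists_getD_of_mem hx
    have := h p hp
    rwa [getD_snoc_lt hp] at this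
  · intro h
    refine ⟨by simp, fun q hq => ?_⟩
    rw [getD_snoc_lt hq]
    exact h _ (getD_mem hq)

theorem activatedSeq_snoc_lt {w : List ℕ} {c p : ℕ} (hp : p < w.length) :
    activatedSeq (w ++ [c]) p = activatedSeq w p ++ if w.getD p 0 < c then [c] else [] := by
  unfold activatedSeq
  rw [getD_snoc_lt hp, drop_append_of_le_length (by omega), filter_append]
  congr 1
  split_ifs with h <;> simpa using h

theorem activatedSeq_snoc_length (w : List ℕ) (c : ℕ) : activatedSeq (w ++ [c]) w.length = [] := by
  unfold activatedSeq
  simp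

theorem activatedSeq_eq_nil_iff (w : List ℕ) (p : ℕ) :
    activatedSeq w p = [] ↔ ∀ q < w.length, p < q → w.getD q 0 ≤ w.getD p 0 := by
  unfold activatedSeq
  rw [filter_eq_nil_iff]
  simp only [decide_eq_true_eq, not_lt]
  constructor
  · intro h q hq hpq
    apply h
    rw [getD_eq_getElem _ _ hq, mem_drop_iff_getElem]
    exact ⟨q - (p + 1), by omega, by congr 1; omega⟩
  · intro h x hx
    rw [mem_drop_iff_getElem] at hx
    obtain ⟨i, hi, rfl⟩ := hx
    rw [← getD_eq_getElem _ 0 (by omega)]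
    exact h _ (by omega) (by omega)

theorem isSuperseded_snoc_lt {w : List ℕ} {c p : ℕ} (hp : p < w.length) :
    IsSuperseded (w ++ [c]) p ↔
      IsSuperseded w p ∨ ((∀ x ∈ w, c ≤ x) ∧ activatedSeq w p = []) := by
  rw [activatedSeq_eq_nil_iff]
  constructor
  · rintro ⟨q, hq, hpq, hm, h⟩
    simp only [length_append, length_singleton] at hq
    rcases (show q < w.length ∨ q = w.length by omega) with hq' | rfl
    · left
      refine ⟨q, hq', hpq, (isLTRMin_snoc_lt hq').1 hm, fun q' h1 h2 => ?_⟩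
      have := h q' h1 h2
      rwa [getD_snoc_lt hp, getD_snoc_lt (h1.trans hq')] at this
    · right
      refine ⟨(isLTRMin_snoc_length _ _).1 hm, fun q' h1 h2 => ?_⟩
      have := h q' h1 h2
      rwa [getD_snoc_lt hp, getD_snoc_lt h1] at this
  · rintro (⟨q, hq, hpq, hm, h⟩ | ⟨h1, h2⟩)
    · refine ⟨q, by simp; omega, hpq, (isLTRMin_snoc_lt hq).2 hm, fun q' h1 h2 => ?_⟩
      rw [getD_snoc_lt hp, getD_snoc_lt (h1.trans hq)]
      exact h q' h1 h2
    · refine ⟨w.length, by simp, hp, (isLTRMin_snoc_length _ _).2 h1, fun q' h3 h4 => ?_⟩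
      rw [getD_snoc_lt hp, getD_snoc_lt h3]
      exact h2 q' h3 h4

/-- Appending `c` fixes the letters above `c`, unless `c` is a left-to-right minimum. -/
theorem isFixed_snoc (w : List ℕ) (c d : ℕ) :
    IsFixed (w ++ [c]) d ↔ IsFixed w d ∨ (c < d ∧ ∃ x ∈ w, x < c) := by
  constructor
  · rintro ⟨q, hq, h1, q', hq', h2⟩
    simp only [length_append, length_singleton] at hq
    rcases (show q < w.length ∨ q = w.length by omega) with hq2 | rfl
    · rw [getD_snoc_lt hq2] at h1 h2
      rw [getD_snoc_lt (hq'.trans hq2)] at h2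
      exact Or.inl ⟨q, hq2, h1, q', hq', h2⟩
    · rw [getD_snoc_length] at h1 h2
      rw [getD_snoc_lt hq'] at h2
      exact Or.inr ⟨h1, _, getD_mem hq', h2⟩
  · rintro (⟨q, hq, h1, q', hq', h2⟩ | ⟨h1, x, hx, h2⟩)
    · refine ⟨q, by simp; omega, by rwa [getD_snoc_lt hq], q', hq', ?_⟩
      rwa [getD_snoc_lt hq, getD_snoc_lt (hq'.trans hq)]
    · obtain ⟨q', hq', rfl⟩ := exists_getD_of_mem hx
      refine ⟨w.length, by simp, by rwa [getD_snoc_length], q', hq', ?_⟩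
      rwa [getD_snoc_length, getD_snoc_lt hq']

theorem IsFixed.exists_letters {w : List ℕ} {d : ℕ} (h : IsFixed w d) :
    ∃ x ∈ w, ∃ y ∈ w, x < y ∧ y < d := by
  obtain ⟨q, hq, h1, q', hq', h2⟩ := h
  exact ⟨_, getD_mem (hq'.trans hq), _, getD_mem hq, h2, h1⟩

/-- A new left-to-right minimum supersedes the minima with an empty sequence; any other letter
deactivates the minima that are not below it. -/
theorem activePositions_snoc (w : List ℕ) (c : ℕ) : activePositions (w ++ [c]) =
    if ∀ x ∈ w, c ≤ x then
      (activePositions w).filter (fun p => activatedSeq w p ≠ []) ++ [w.length]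
    else (activePositions w).filter (fun p => w.getD p 0 < c) := by
  have hrange : range (w ++ [c]).length = range w.length ++ [w.length] := by
    rw [length_append, length_singleton, range_succ]
  unfold activePositions
  rw [hrange, filter_append]
  split_ifs with h
  · congr 1
    · rw [filter_filter]
      apply filter_congr
      intro p hp
      rw [mem_range] at hp
      have hd : IsDeactivated (w ++ [c]) p ↔ IsDeactivated w p := by
        unfold IsDeactivated
        rw [getD_snoc_lt hp, isFixed_snoc, or_iff_left_iff_imp]
        rintro ⟨-, x, hx, hxc⟩
        exact absurd (h x hx) (by omega)
      rw [← Bool.decide_and, decide_eq_decide, isLTRMin_snoc_lt hp, isSuperseded_snoc_lt hp, hd]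
      tauto
    · rw [filter_cons_of_pos]
      · rfl
      rw [decide_eq_true_eq, isLTRMin_snoc_length]
      refine ⟨h, ?_, ?_⟩
      · rintro ⟨q, hq, hpq, -⟩
        simp at hq
        omega
      · unfold IsDeactivated
        rw [getD_snoc_length, isFixed_snoc]
        rintro (hf | ⟨-, x, hx, hxc⟩)
        · obtain ⟨x, hx, y, hy, hxy, hyd⟩ := hf.exists_letters
          have := h x hx
          omega
        · exact absurd (h x hx) (by omega)
  · have h2 : filter (fun p => decide (IsLTRMin (w ++ [c]) p ∧ ¬ IsSuperseded (w ++ [c]) p ∧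
        ¬ IsDeactivated (w ++ [c]) p)) [w.length] = [] := by
      rw [filter_cons_of_neg]
      · rfl
      rw [decide_eq_true_eq, isLTRMin_snoc_length]
      tauto
    rw [h2, append_nil, filter_filter]
    apply filter_congr
    intro p hp
    rw [mem_range] at hp
    have hd : IsDeactivated (w ++ [c]) p ↔ IsDeactivated w p ∨ c ≤ w.getD p 0 := by
      unfold IsDeactivated
      rw [getD_snoc_lt hp, isFixed_snoc]
      push Not at h
      have := Nat.lt_succ_iff (m := c) (n := w.getD p 0)
      tauto
    rw [← Bool.decide_and, decide_eq_decide, isLTRMin_snoc_lt hp, isSuperseded_snoc_lt hp, hd]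
    have := Nat.not_le (a := c) (b := w.getD p 0)
    tauto

theorem lt_length_of_mem_activePositions {w : List ℕ} {p : ℕ} (hp : p ∈ activePositions w) :
    p < w.length := by
  unfold activePositions at hp
  simpa using mem_of_mem_filter hp

/-- The case distinction still refers to all letters of `w`; see `activeList_snoc`. -/
theorem activeList_snoc_aux (w : List ℕ) (c : ℕ) : activeList (w ++ [c]) =
    if ∀ x ∈ w, c ≤ x then (activeList w).filter (fun x => x.2 ≠ []) ++ [(c, [])]
    else ((activeList w).filter (fun x => x.1 < c)).map (fun x => (x.1, x.2 ++ [c])) := by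
  unfold activeList
  rw [activePositions_snoc]
  split_ifs with h
  · rw [map_append, filter_map]
    congr 1
    · apply map_congr_left
      intro p hp
      have hp := lt_length_of_mem_activePositions (mem_of_mem_filter hp)
      rw [getD_snoc_lt hp, activatedSeq_snoc_lt hp, if_neg (not_lt.2 (h _ (getD_mem hp))),
        append_nil]
    · simp only [map_cons, map_nil, getD_snoc_length, activatedSeq_snoc_length]
  · rw [filter_map, map_map]
    apply map_congr_left
    intro p hp
    have hp2 := of_mem_filter hp
    have hp := lt_length_of_mem_activePositions (mem_of_mem_filter hp)
    simp only [decide_eq_true_eq] at hp2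
    simp only [Function.comp]
    rw [getD_snoc_lt hp, activatedSeq_snoc_lt hp, if_pos hp2]

/-- The least letter of a word is always an active minimum. -/
theorem exists_activeList_le (w : List ℕ) : ∀ x ∈ w, ∃ y ∈ activeList w, y.1 ≤ x := by
  induction w using reverseRecOn with
  | nil => simp
  | append_singleton w c ih =>
    intro x hx
    rw [activeList_snoc_aux]
    split_ifs with h
    · refine ⟨(c, []), by simp, ?_⟩
      rcases mem_append.1 hx with hx | hx
      · exact h x hx
      · simp at hx; exact hx.ge
    · have key : ∃ x' ∈ w, x' ≤ x ∧ x' < c := by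
        push Not at h
        obtain ⟨x', hx', hc⟩ := h
        rcases mem_append.1 hx with hx | hx
        · rcases le_total x x' with hxx | hxx
          · exact ⟨x, hx, le_rfl, by omega⟩
          · exact ⟨x', hx', hxx, hc⟩
        · simp at hx
          exact ⟨x', hx', by omega, hc⟩
      obtain ⟨x', hx', h1, h2⟩ := key
      obtain ⟨y, hy, hyx⟩ := ih x' hx'
      refine ⟨(y.1, y.2 ++ [c]), mem_map.2 ⟨y, mem_filter.2 ⟨hy, by simp; omega⟩, rfl⟩, ?_⟩
      simp; omega

theorem exists_mem_of_mem_activeList {w : List ℕ} {x : ℕ × List ℕ} (hx : x ∈ activeList w) :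
    ∃ p ∈ activePositions w, w.getD p 0 = x.1 ∧ activatedSeq w p = x.2 := by
  obtain ⟨p, hp, rfl⟩ := mem_map.1 hx
  exact ⟨p, hp, rfl, rfl⟩

theorem fst_mem_of_mem_activeList {w : List ℕ} {x : ℕ × List ℕ} (hx : x ∈ activeList w) :
    x.1 ∈ w := by
  obtain ⟨p, hp, h, -⟩ := exists_mem_of_mem_activeList hx
  exact h ▸ getD_mem (lt_length_of_mem_activePositions hp)

/-- Active minima and activated sequences determine how they evolve. -/
theorem activeList_snoc (w : List ℕ) (c : ℕ) :
    activeList (w ++ [c]) = appendLetter (activeList w) c := by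
  rw [activeList_snoc_aux, appendLetter]
  have : (∀ x ∈ w, c ≤ x) ↔ ∀ x ∈ activeList w, c ≤ x.1 := by
    constructor
    · intro h x hx
      exact h _ (fst_mem_of_mem_activeList hx)
    · intro h x hx
      obtain ⟨y, hy, hyx⟩ := exists_activeList_le w x hx
      exact (h y hy).trans hyx
  simp only [this]

theorem Nested.appendLetter {P : List (ℕ × List ℕ)} (hP : Nested P) (c : ℕ) :
    Nested (appendLetter P c) := by
  unfold WordRecurrence.appendLetter
  split_ifs with h
  · constructor
    · rw [pairwise_append]
      refine ⟨hP.chain.filter _, pairwise_singleton _ _, ?_⟩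
      intro x hx y hy
      simp only [mem_singleton] at hy
      subst hy
      have h2 := of_mem_filter hx
      simp only [ne_eq, decide_not, Bool.not_eq_eq_eq_not, Bool.not_true, decide_eq_false_iff_not]
        at h2
      exact ⟨h x (mem_of_mem_filter hx), nil_suffix, fun e => h2 e.symm⟩
    · intro x hx d hd y hy
      rcases mem_append.1 hx with hx | hx
      · have hx := mem_of_mem_filter hx
        rcases mem_append.1 hy with hy | hy
        · exact hP.above x hx d hd y (mem_of_mem_filter hy)
        · simp only [mem_singleton] at hy
          subst hy
          exact lt_of_le_of_lt (h x hx) (hP.above x hx d hd x hx)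
      · simp only [mem_singleton] at hx
        subst hx
        simp at hd
  · constructor
    · rw [pairwise_map]
      refine (hP.chain.filter _).imp ?_
      rintro x y ⟨h1, h2, h3⟩
      refine ⟨h1, ?_, fun e => h3 (append_cancel_right e)⟩
      obtain ⟨t, ht⟩ := h2
      exact ⟨t, by rw [← append_assoc, ht]⟩
    · intro x hx d hd y hy
      obtain ⟨x', hx', rfl⟩ := mem_map.1 hx
      obtain ⟨y', hy', rfl⟩ := mem_map.1 hy
      rcases mem_append.1 hd with hd | hd
      · exact hP.above x' (mem_of_mem_filter hx') d hd y' (mem_of_mem_filter hy')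
      · simp only [mem_singleton] at hd
        subst hd
        simpa using of_mem_filter hy'

theorem nested_nil : Nested [] := ⟨Pairwise.nil, by simp⟩

theorem activeList_nil : activeList [] = [] := rfl

theorem nested_activeList (w : List ℕ) : Nested (activeList w) := by
  induction w using reverseRecOn with
  | nil => exact nested_nil
  | append_singleton w c ih => rw [activeList_snoc]; exact ih.appendLetter c

/-- One position of the word is enough to account for the letter that is appended. -/
theorem count_appendLetter_le {P : List (ℕ × List ℕ)} {d c n : ℕ}
    (h : ∀ s ∈ [] :: P.map Prod.snd, (P.map Prod.fst).count c + s.count c ≤ n) :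
    ∀ s ∈ [] :: (appendLetter P d).map Prod.snd,
      ((appendLetter P d).map Prod.fst).count c + s.count c ≤ n + [d].count c := by
  intro s hs
  rw [appendLetter] at hs ⊢
  split_ifs at hs ⊢
  · have hs' : s ∈ [] :: P.map Prod.snd := by
      simp only [map_append, map_cons, map_nil, mem_cons, mem_append, mem_map] at hs ⊢
      rcases hs with hs | ⟨x, hx, hs⟩ | hs | hs
      · exact Or.inl hs
      · exact Or.inr ⟨x, mem_of_mem_filter hx, hs⟩
      · exact Or.inl hs
      · simp at hs
    have h1 := h s hs'
    have h2 := ((filter_sublist (l := P) (p := fun x => x.2 ≠ [])).map Prod.fst).count_le c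
    rw [map_append, count_append]
    simp only [map_cons, map_nil]
    omega
  · have h2 := ((filter_sublist (l := P) (p := fun x => x.1 < d)).map Prod.fst).count_le c
    have he : (Prod.fst ∘ fun x : ℕ × List ℕ => (x.1, x.2 ++ [d])) = Prod.fst := rfl
    rw [map_map, he]
    rcases mem_cons.1 hs with rfl | hs
    · have h1 := h [] (by simp)
      omega
    · simp only [map_map, mem_map, mem_filter, Function.comp] at hs
      obtain ⟨x, ⟨hx, -⟩, rfl⟩ := hs
      have h1 := h x.2 (mem_cons_of_mem _ (mem_map_of_mem hx))
      rw [count_append]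
      omega

/-- The active minima, together with the letters of any one activated sequence, occupy distinct
positions of the word. -/
theorem count_activeList_le (w : List ℕ) (c : ℕ) : ∀ s ∈ [] :: (activeList w).map Prod.snd,
    ((activeList w).map Prod.fst).count c + s.count c ≤ w.count c := by
  induction w using reverseRecOn with
  | nil => simp [activeList_nil]
  | append_singleton w d ih =>
    rw [activeList_snoc, count_append]
    exact count_appendLetter_le ih

/-- Which letters are fixed is visible in the activated sequences of the active minima. -/
theorem IsFixed.exists_activeList {w : List ℕ} {d : ℕ} (h : IsFixed w d) :
    ∃ x ∈ activeList w, ∃ y ∈ x.2, y < d := by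
  induction w using reverseRecOn with
  | nil => obtain ⟨x, hx, -⟩ := h.exists_letters; simp at hx
  | append_singleton w c ih =>
    rw [activeList_snoc_aux]
    rw [isFixed_snoc] at h
    split_ifs with hc
    · rcases h with h | ⟨-, x, hx, hxc⟩
      · obtain ⟨x, hx, y, hy, hyd⟩ := ih h
        exact ⟨x, mem_append_left _ (mem_filter.2 ⟨hx, by simpa using ne_nil_of_mem hy⟩),
          y, hy, hyd⟩
      · exact absurd (hc x hx) (by omega)
    · push Not at hc
      obtain ⟨x, hx, hxc⟩ := hc
      obtain ⟨y, hy, hyx⟩ := exists_activeList_le w x hx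
      by_cases hcd : c < d
      · exact ⟨_, mem_map.2 ⟨y, mem_filter.2 ⟨hy, by simp; omega⟩, rfl⟩, c, by simp, hcd⟩
      · rcases h with h | ⟨h, -⟩
        · obtain ⟨x, hx, y, hy, hyd⟩ := ih h
          have := (nested_activeList w).above x hx y hy x hx
          exact ⟨_, mem_map.2 ⟨x, mem_filter.2 ⟨hx, by simp; omega⟩, rfl⟩, y, by simp [hy], hyd⟩
        · exact absurd h hcd

/-! ### Completions in terms of the active minima -/

/-- The conditions on the numbers `ρ c` of remaining letters and on the list `P` of active minima
and activated sequences that hold for every partial word, and that suffice for a partial word to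
exist. -/
structure Valid (r k : ℕ) (ρ : ℕ → ℕ) (P : List (ℕ × List ℕ)) : Prop where
  nested : Nested P
  count_le : ∀ c, ∀ s ∈ [] :: P.map Prod.snd, (P.map Prod.fst).count c + s.count c + ρ c ≤ r
  good : ∀ x ∈ P, Good k x.2
  not_inevitable : ∀ x ∈ P, ∀ c, ρ c ≠ 0 → x.1 < c → ¬ IncSub 3 (x.2 ++ [c])

/-- The completions, as far as they are determined by the numbers `ρ c` of remaining letters and the
list `P` of active minima and activated sequences. -/
def Comp (k : ℕ) (ρ : ℕ → ℕ) (P : List (ℕ × List ℕ)) : Set (List ℕ) :=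
  {z | (∀ c, z.count c = ρ c) ∧ Avoids k z ∧
    ∀ x ∈ P, Good k (x.2 ++ z.filter (fun c => x.1 < c))}

theorem cons_activatedSeq_sublist {w : List ℕ} {p : ℕ} (hp : p < w.length) (z : List ℕ) :
    w.getD p 0 :: (activatedSeq w p ++ z.filter (fun c => w.getD p 0 < c)) <+ w ++ z := by
  rw [← cons_append]
  refine Sublist.append ?_ filter_sublist
  unfold activatedSeq
  have : w.drop p = w.getD p 0 :: w.drop (p + 1) := by
    rw [getD_eq_getElem _ _ hp]; exact drop_eq_getElem_cons hp
  exact (filter_sublist.cons_cons _).trans (this ▸ drop_sublist p w)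

theorem AllAbove.activatedSeq {G : List ℕ → Prop} {w z : List ℕ} (h : AllAbove G (w ++ z)) {p : ℕ}
    (hp : p < w.length) : G (activatedSeq w p ++ z.filter (fun c => w.getD p 0 < c)) := by
  refine h _ _ (cons_activatedSeq_sublist hp z) fun y hy => ?_
  rcases mem_append.1 hy with hy | hy <;> simpa using of_mem_filter hy

theorem filter_lt_sublist_of_le {m n : ℕ} (h : m ≤ n) (v : List ℕ) :
    v.filter (fun c => n < c) <+ v.filter (fun c => m < c) := by
  apply monotone_filter_right
  intro c hc
  simp only [decide_eq_true_eq] at hc ⊢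
  omega

theorem exists_isLTRMin_le (w : List ℕ) (p : ℕ) (hp : p < w.length) :
    ∃ q ≤ p, IsLTRMin w q ∧ w.getD q 0 ≤ w.getD p 0 := by
  induction p using Nat.strong_induction_on with
  | _ p ih =>
    by_cases h : IsLTRMin w p
    · exact ⟨p, le_rfl, h, le_rfl⟩
    · unfold IsLTRMin at h
      push Not at h
      obtain ⟨q, hq, hqp⟩ := h hp
      obtain ⟨q', h1, h2, h3⟩ := ih q hq (hq.trans hp)
      exact ⟨q', by omega, h2, by omega⟩

/-- What exceeds a superseded minimum also exceeds, and follows, the one by which it was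
superseded. -/
theorem exists_not_isSuperseded (w : List ℕ) (n p : ℕ) (hn : w.length - p ≤ n) (hp : IsLTRMin w p) :
    ∃ q, IsLTRMin w q ∧ ¬ IsSuperseded w q ∧ w.getD q 0 ≤ w.getD p 0 ∧
      activatedSeq w p <+ activatedSeq w q := by
  induction n generalizing p with
  | zero => have := hp.1; omega
  | succ n ih =>
    by_cases h : IsSuperseded w p
    · obtain ⟨q, hq, hpq, hm, hb⟩ := h
      obtain ⟨q', h1, h2, h3, h4⟩ := ih q (by omega) hm
      have hqp := hm.2 p hpq
      refine ⟨q', h1, h2, h3.trans hqp, Sublist.trans ?_ h4⟩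
      -- the letters up to position `q` do not exceed the minimum at position `p`
      have hsplit : w.drop (p + 1) = (w.drop (p + 1)).take (q - p) ++ w.drop (q + 1) := by
        conv_lhs => rw [← take_append_drop (q - p) (w.drop (p + 1))]
        rw [drop_drop]
        congr 2
        omega
      unfold activatedSeq
      rw [hsplit, filter_append, filter_eq_nil_iff.2, nil_append]
      · exact filter_lt_sublist_of_le hqp _
      · intro x hx
        obtain ⟨i, hi, rfl⟩ := getElem_of_mem hx
        simp only [length_take, length_drop, lt_inf_iff] at hi
        simp only [getElem_take, getElem_drop, decide_eq_true_eq, not_lt]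
        rw [← getD_eq_getElem _ 0 (by omega)]
        rcases (show p + 1 + i < q ∨ p + 1 + i = q by omega) with h' | h'
        · exact hb _ h' (by omega)
        · rw [h']; exact hqp
    · exact ⟨p, hp, h, le_rfl, Sublist.refl _⟩

/-- A forbidden pattern whose first letter lies in `w` may be assumed to start with a left-to-right
minimum that has not been superseded. -/
theorem allAbove_append {G : List ℕ → Prop} (hG : ∀ u v, u <+ v → G v → G u) {w z : List ℕ}
    (hz : AllAbove G z) (h : ∀ p, IsLTRMin w p → ¬ IsSuperseded w p →
      G (activatedSeq w p ++ z.filter (fun c => w.getD p 0 < c))) : AllAbove G (w ++ z) := by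
  intro x u hu hx
  rw [cons_sublist_iff] at hu
  obtain ⟨l₁, l₂, hw, hx1, hu⟩ := hu
  rcases append_eq_append_iff.1 hw with ⟨as, rfl, rfl⟩ | ⟨bs, rfl, rfl⟩
  · rcases mem_append.1 hx1 with hx1 | hx1
    · obtain ⟨p, hp, rfl⟩ := exists_getD_of_mem hx1
      obtain ⟨q, h1, h2, h3⟩ := exists_isLTRMin_le w p hp
      obtain ⟨q', h4, h5, h6, h7⟩ := exists_not_isSuperseded w _ q le_rfl h2
      refine hG _ _ ?_ (h q' h4 h5)
      have hu' : u <+ (as ++ l₂).filter (fun c => w.getD p 0 < c) := by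
        have := (hu.trans (sublist_append_right as l₂)).filter (fun c => decide (w.getD p 0 < c))
        rwa [filter_eq_self.2 (by simpa using hx)] at this
      exact hu'.trans ((filter_lt_sublist_of_le (h6.trans h3) _).trans (sublist_append_right _ _))
    · refine hz x u ?_ hx
      exact Sublist.append (singleton_sublist.2 hx1) hu
  · obtain ⟨p, hp, rfl⟩ := exists_getD_of_mem hx1
    have hp' : p < (l₁ ++ bs).length := by simp; omega
    have hv : (l₁ ++ bs).getD p 0 = l₁.getD p 0 := getD_append _ _ _ _ hp
    obtain ⟨q, h1, h2, h3⟩ := exists_isLTRMin_le (l₁ ++ bs) p hp'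
    obtain ⟨q', h4, h5, h6, h7⟩ := exists_not_isSuperseded _ _ q le_rfl h2
    refine hG _ _ ?_ (h q' h4 h5)
    rw [hv] at h3
    have hu' : u <+ (bs ++ z).filter (fun c => l₁.getD p 0 < c) := by
      have := hu.filter (fun c => decide (l₁.getD p 0 < c))
      rwa [filter_eq_self.2 (by simpa using hx)] at this
    refine hu'.trans ?_
    rw [filter_append]
    refine Sublist.append ?_ (filter_lt_sublist_of_le (h6.trans h3) _)
    refine Sublist.trans ?_ h7
    unfold activatedSeq
    refine (filter_lt_sublist_of_le h3 _).trans (Sublist.filter _ ?_)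
    rw [drop_append_of_le_length (by omega)]
    exact sublist_append_right _ _

theorem not_incSub_append_of_weaklyDecreasing {s f : List ℕ} (hs : ¬ IncSub 3 s)
    (hf : f.Pairwise (· ≥ ·)) (h : ∀ c ∈ f, ¬ IncSub 3 (s ++ [c])) : ¬ IncSub 3 (s ++ f) := by
  rintro ⟨u, hu, hl, hp⟩
  obtain ⟨u₁, u₂, rfl, h1, h2⟩ := sublist_append_iff.1 hu
  match u₂ with
  | [] => exact hs ⟨u₁, h1, by simpa using hl, by simpa using hp⟩
  | [c] => exact h c (h2.subset (by simp)) ⟨u₁ ++ [c], h1.append (Sublist.refl _), hl, hp⟩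
  | c :: d :: u =>
    have h3 := (pairwise_append.1 hp).2.1
    have h4 := hf.sublist h2
    simp only [pairwise_cons, mem_cons, forall_eq_or_imp] at h3 h4
    have := h3.1.1
    have := h4.1.1
    omega

theorem count_flatMap_replicate (g : ℕ → ℕ) (v : List ℕ) (hv : v.Nodup) (c : ℕ) :
    (v.flatMap (fun j => replicate (g j) j)).count c = if c ∈ v then g c else 0 := by
  induction v with
  | nil => simp
  | cons x v ih =>
    rw [nodup_cons] at hv
    rw [flatMap_cons, count_append, ih hv.2, count_replicate]
    by_cases hx : x = c
    · subst hx; simp [hv.1]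
    · have : ¬ c = x := fun e => hx e.symm
      simp [hx, this]

theorem entry_eq_zero_of_length_lt {L : List ℕ} {i : ℕ} (h : L.length < i) : entry L i = 0 := by
  unfold entry
  rw [if_neg (by omega), getD_eq_default _ _ (by omega)]

/-- The decreasing arrangement in `fix` is the only one. -/
theorem fix_eq_append {m : ℕ} {L f : List ℕ} (s : List ℕ) (hf : f.Pairwise (· ≥ ·))
    (hc : ∀ c, f.count c = if m < c then entry L c else 0) : fix m s L = s ++ f := by
  unfold fix
  congr 1
  have hp : (range' (m + 1) (L.length - m)).reverse.Pairwise (· > ·) := reverse_range'_pairwise _ _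
  refine Perm.eq_of_pairwise (le := (· ≥ ·)) (fun a b _ _ h1 h2 => le_antisymm h2 h1) ?_ hf ?_
  · rw [pairwise_flatMap]
    refine ⟨fun a _ => by simp [pairwise_replicate], hp.imp ?_⟩
    intro a b hab x hx y hy
    rw [(mem_replicate.1 hx).2, (mem_replicate.1 hy).2]
    exact hab.le
  · rw [perm_iff_count]
    intro c
    rw [count_flatMap_replicate _ _ (hp.imp (fun h => h.ne')), hc]
    simp only [mem_reverse, mem_range'_1]
    split_ifs with h1 h2 h2
    · rfl
    · omega
    · exact (entry_eq_zero_of_length_lt (by omega)).symm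
    · rfl

theorem count_filter_lt {z : List ℕ} {ρ : ℕ → ℕ} (hz : ∀ c, z.count c = ρ c) (m c : ℕ) :
    (z.filter (fun c => m < c)).count c = if m < c then ρ c else 0 := by
  split_ifs with h
  · rw [count_filter (by simpa using h), hz]
  · rw [count_eq_zero]
    simp [h]

theorem entry_replicate_append (r a c : ℕ) (L : List ℕ) :
    entry (replicate a r ++ L) c = remaining r a L c := by
  unfold remaining
  split_ifs with h
  · unfold entry
    rw [if_neg (by omega), getD_append _ _ _ _ (by simp; omega),
      getD_eq_getElem _ _ (by simp; omega)]
    simp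
  · unfold entry
    by_cases hc : c = 0
    · simp [hc]
    · rw [if_neg hc, if_neg (by omega), getD_append_right _ _ _ _ (by simp; omega)]
      simp only [length_replicate]
      congr 1
      omega

/-- An ascent from `b` to `y` forces the later letters above `y` to decrease. -/
theorem weaklyDecreasing_of_good {k m y b : ℕ} {s z : List ℕ}
    (hg : Good k (s ++ z.filter (fun c => b < c))) (hy : y ∈ s) (hb : b < y) (hym : y ≤ m) :
    (z.filter (fun c => m < c)).Pairwise (· ≥ ·) := by
  rw [pairwise_iff_forall_sublist]
  intro c d hcd
  by_contra hlt
  have hc : m < c := by simpa using of_mem_filter (hcd.subset (mem_cons_self (a := c)))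
  refine hg.1 ⟨[y] ++ [c, d], (singleton_sublist.2 hy).append
    (hcd.trans (filter_lt_sublist_of_le (by omega) z)), rfl, ?_⟩
  simp
  omega

theorem IsPartialWord.not_incSub {r k a : ℕ} {σ : State} {w : List ℕ} (h : IsPartialWord r k a σ w)
    {p : ℕ} (hp : p < w.length) {c : ℕ} (hc : remaining r a σ.counts c ≠ 0)
    (hpc : w.getD p 0 < c) : ¬ IncSub 3 (activatedSeq w p ++ [c]) := by
  have h1 := h.not_inevitable c (Nat.pos_of_ne_zero hc)
  rw [contains_1234_iff, not_not] at h1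
  have h2 := h1.activatedSeq hp
  rwa [filter_eq_self.2 (by simpa using hpc)] at h2

theorem IsPartialWord.good {r k a : ℕ} {σ : State} {w : List ℕ} (h : IsPartialWord r k a σ w)
    {p : ℕ} (hp : p < w.length) : Good k (activatedSeq w p) := by
  have h1 := (avoids_iff _ _).1 h.avoids
  rw [← append_nil w] at h1
  simpa using h1.activatedSeq hp

/-- The completions of a partial word depend on the active minima and their activated sequences
only: the letters above a deactivated minimum are forced to decrease, and then cause no harm. -/
theorem IsPartialWord.completions_eq {r k a : ℕ} {σ : State} {w : List ℕ}
    (h : IsPartialWord r k a σ w) :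
    completions r k a σ.counts w = Comp k (remaining r a σ.counts) (activeList w) := by
  ext z
  constructor
  · rintro ⟨h1, h2⟩
    rw [avoids_iff] at h2
    refine ⟨h1, (avoids_iff _ _).2 (h2.mono (sublist_append_right _ _)), fun x hx => ?_⟩
    obtain ⟨p, hp, hx1, hx2⟩ := exists_mem_of_mem_activeList hx
    rw [← hx1, ← hx2]
    exact h2.activatedSeq (lt_length_of_mem_activePositions hp)
  · rintro ⟨h1, h2, h3⟩
    refine ⟨h1, (avoids_iff _ _).2 (allAbove_append (good_closed k) ((avoids_iff _ _).1 h2) ?_)⟩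
    intro p hp hsup
    by_cases hd : IsDeactivated w p
    · obtain ⟨x, hx, y, hy, hyp⟩ := IsFixed.exists_activeList hd
      have hf := weaklyDecreasing_of_good (m := w.getD p 0) (h3 x hx) hy
        ((nested_activeList w).above x hx y hy x hx) (by omega)
      constructor
      · refine not_incSub_append_of_weaklyDecreasing (h.good hp.1).1 hf fun c hc => ?_
        have hc' := mem_filter.1 hc
        refine h.not_incSub hp.1 ?_ (by simpa using hc'.2)
        rw [← h1]
        exact (count_pos_iff.2 hc'.1).ne'
      · have := h.deactivated p hp hsup hd
        rwa [contains_patternDesc_iff, fix_eq_append _ hf] at this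
        intro c
        rw [count_filter_lt h1, entry_replicate_append]
    · refine h3 (w.getD p 0, activatedSeq w p) (mem_map.2 ⟨p, ?_, rfl⟩)
      exact mem_filter.2 ⟨mem_range.2 hp.1, by simp [hp, hsup, hd]⟩

/-! ### A word with given active minima -/

theorem activeList_append_of_lt {w : List ℕ} (hne : activeList w ≠ []) (s : List ℕ)
    (hs : ∀ c ∈ s, ∀ x ∈ activeList w, x.1 < c) :
    activeList (w ++ s) = (activeList w).map (fun x => (x.1, x.2 ++ s)) := by
  induction s using reverseRecOn with
  | nil => simp
  | append_singleton s c ih =>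
    have hc : ∀ x ∈ activeList w, x.1 < c := hs c (by simp)
    rw [← append_assoc, activeList_snoc, ih (fun d hd => hs d (by simp [hd])), appendLetter, if_neg,
      filter_eq_self.2, map_map]
    · simp
    · intro x hx
      obtain ⟨y, hy, rfl⟩ := mem_map.1 hx
      simpa using hc y hy
    · intro hall
      obtain ⟨x, hx⟩ := exists_mem_of_ne_nil _ hne
      have := hall _ (mem_map_of_mem hx)
      have := hc x hx
      simp only at *
      omega

/-- Each nested list is realized by the word in which every minimum is followed by the letters that
its activated sequence does not share with the next one. -/
theorem Nested.exists_word {P : List (ℕ × List ℕ)} (hP : Nested P) :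
    ∃ w, activeList w = P ∧
      (∀ c, w.count c = (P.map Prod.fst).count c + ((P.map Prod.snd).headD []).count c) ∧
      w.head? = P.head?.map Prod.fst := by
  induction hn : P.length generalizing P with
  | zero =>
    rw [length_eq_zero_iff] at hn
    subst hn
    exact ⟨[], rfl, by simp, rfl⟩
  | succ n ih =>
    have hne : P ≠ [] := by rintro rfl; simp at hn
    obtain ⟨P₀, ⟨m, s⟩, rfl⟩ := (eq_nil_or_concat' P).resolve_left hne
    -- the last sequence `s` is a suffix of the others, and is split off from them
    set strip : ℕ × List ℕ → ℕ × List ℕ := fun x => (x.1, x.2.take (x.2.length - s.length))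
      with hstrip
    have hch := pairwise_append.1 hP.chain
    have hsuf : ∀ x ∈ P₀, (strip x).2 ++ s = x.2 := fun x hx =>
      suffix_iff_eq_append.1 (hch.2.2 x hx (m, s) (by simp)).2.1
    have hnil : ∀ x ∈ P₀, (strip x).2 ≠ [] := by
      intro x hx e
      have := hsuf x hx
      rw [e, nil_append] at this
      exact (hch.2.2 x hx (m, s) (by simp)).2.2 this
    have hmin : ∀ x ∈ P₀, m ≤ x.1 := fun x hx => (hch.2.2 x hx (m, s) (by simp)).1
    have hN : Nested (P₀.map strip) := by
      constructor
      · rw [pairwise_map]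
        refine hch.1.imp_of_mem ?_
        rintro x y hx hy ⟨h1, ⟨t, ht⟩, h3⟩
        rw [← hsuf x hx, ← hsuf y hy, ← append_assoc] at ht
        refine ⟨h1, ⟨t, append_cancel_right ht⟩, fun e => h3 ?_⟩
        rw [← hsuf x hx, ← hsuf y hy, e]
      · intro x hx c hc y hy
        obtain ⟨x', hx', rfl⟩ := mem_map.1 hx
        obtain ⟨y', hy', rfl⟩ := mem_map.1 hy
        refine hP.above x' (mem_append_left _ hx') c ?_ y' (mem_append_left _ hy')
        rw [← hsuf x' hx']
        exact mem_append_left _ hc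
    obtain ⟨w, hw, hcount, hhead⟩ := ih hN (by simpa using hn)
    have hstep : activeList (w ++ [m]) = P₀.map strip ++ [(m, [])] := by
      rw [activeList_snoc, hw, WordRecurrence.appendLetter, if_pos, filter_eq_self.2]
      · intro x hx
        obtain ⟨x', hx', rfl⟩ := mem_map.1 hx
        simpa using hnil x' hx'
      · intro x hx
        obtain ⟨x', hx', rfl⟩ := mem_map.1 hx
        exact hmin x' hx'
    refine ⟨w ++ [m] ++ s, ?_, ?_, ?_⟩
    · rw [activeList_append_of_lt (by rw [hstep]; simp), hstep, map_append, map_map]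
      · congr 1
        conv_rhs => rw [← map_id P₀]
        apply map_congr_left
        intro x hx
        exact Prod.ext rfl (hsuf x hx)
      · intro c hc x hx
        rw [hstep] at hx
        have key := hP.above (m, s) (by simp) c hc
        rcases mem_append.1 hx with hx | hx
        · obtain ⟨x', hx', rfl⟩ := mem_map.1 hx
          exact key x' (mem_append_left _ hx')
        · simp only [mem_singleton] at hx
          subst hx
          exact key (m, s) (by simp)
    · intro c
      rw [count_append, count_append, hcount]
      have hfst : Prod.fst ∘ strip = Prod.fst := rfl
      rw [map_append, count_append, map_map, hfst]
      rcases P₀ with _ | ⟨x, P₀⟩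
      · simp
      · have := congrArg (count c) (hsuf x (by simp))
        rw [count_append] at this
        simp only [map_cons, map_nil, cons_append, headD_cons]
        omega
    · rcases P₀ with _ | ⟨x, P₀⟩
      · simp at hhead
        subst hhead
        simp
      · rw [append_assoc, head?_append, hhead]
        simp [hstrip]

/-! ### Relabelling and states -/

/-- The letters of a list of minima and sequences are replaced by their images under `g`. -/
def relabel (g : ℕ → ℕ) (P : List (ℕ × List ℕ)) : List (ℕ × List ℕ) :=
  P.map (fun x => (g x.1, x.2.map g))

theorem suffix_map_iff {g : ℕ → ℕ} (hg : StrictMono g) {s t : List ℕ} :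
    s.map g <:+ t.map g ↔ s <:+ t := by
  rw [suffix_iff_eq_drop, suffix_iff_eq_drop, length_map, length_map, ← map_drop,
    (map_injective_iff.2 hg.injective).eq_iff]

theorem nested_relabel {g : ℕ → ℕ} (hg : StrictMono g) (P : List (ℕ × List ℕ)) :
    Nested (relabel g P) ↔ Nested P := by
  have hinj := map_injective_iff.2 hg.injective
  constructor
  · rintro ⟨h1, h2⟩
    refine ⟨?_, fun x hx c hc y hy => ?_⟩
    · rw [relabel, pairwise_map] at h1
      exact h1.imp fun ⟨h3, h4, h5⟩ => ⟨hg.le_iff_le.1 h3, (suffix_map_iff hg).1 h4,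
        fun e => h5 (by rw [e])⟩
    · exact hg.lt_iff_lt.1 (h2 _ (mem_map_of_mem hx) _ (mem_map_of_mem hc) _ (mem_map_of_mem hy))
  · rintro ⟨h1, h2⟩
    constructor
    · rw [relabel, pairwise_map]
      exact h1.imp fun ⟨h3, h4, h5⟩ => ⟨hg.le_iff_le.2 h3, (suffix_map_iff hg).2 h4,
        fun e => h5 (hinj e)⟩
    · intro x hx c hc y hy
      obtain ⟨x', hx', rfl⟩ := mem_map.1 hx
      obtain ⟨c', hc', rfl⟩ := mem_map.1 hc
      obtain ⟨y', hy', rfl⟩ := mem_map.1 hy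
      exact hg (h2 x' hx' c' hc' y' hy')

theorem map_fst_relabel (g : ℕ → ℕ) (P : List (ℕ × List ℕ)) :
    (relabel g P).map Prod.fst = (P.map Prod.fst).map g := by
  simp [relabel]

theorem map_snd_relabel (g : ℕ → ℕ) (P : List (ℕ × List ℕ)) :
    (relabel g P).map Prod.snd = (P.map Prod.snd).map (List.map g) := by
  simp [relabel]

/-- Validity can be pulled back along a relabelling, even if fewer copies remain. -/
theorem Valid.of_relabel {r k : ℕ} {g : ℕ → ℕ} (hg : StrictMono g) {ρ ρ' : ℕ → ℕ}
    {P : List (ℕ × List ℕ)} (h : Valid r k ρ (relabel g P)) (hρ : ∀ c, ρ' c ≤ ρ (g c)) :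
    Valid r k ρ' P where
  nested := (nested_relabel hg P).1 h.nested
  count_le c s hs := by
    have hs' : s.map g ∈ [] :: (relabel g P).map Prod.snd := by
      rw [map_snd_relabel]
      rcases mem_cons.1 hs with rfl | hs
      · simp
      · exact mem_cons_of_mem _ (mem_map_of_mem hs)
    have := h.count_le (g c) _ hs'
    rw [map_fst_relabel, count_map_of_injective _ _ hg.injective,
      count_map_of_injective _ _ hg.injective] at this
    exact (Nat.add_le_add_left (hρ c) _).trans this
  good x hx := (good_map hg k _).1 (h.good _ (mem_map_of_mem hx))
  not_inevitable x hx c hc hxc hinc := by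
    refine h.not_inevitable _ (mem_map_of_mem hx) (g c) (by have := hρ c; omega) (hg hxc) ?_
    have := (incSub_map hg 3 _).2 hinc
    simpa using this

/-- Validity is kept by relabelling; besides the images of the old letters, letters below all of
these may remain. -/
theorem Valid.relabel {r k : ℕ} {g : ℕ → ℕ} (hg : StrictMono g) {ρ ρ' : ℕ → ℕ}
    {P : List (ℕ × List ℕ)} (h : Valid r k ρ P) (hP : ∀ x ∈ P, 1 ≤ x.1 ∧ ∀ c ∈ x.2, 1 ≤ c)
    (hρ : ∀ c, 1 ≤ c → ρ' (g c) = ρ c) (hr : ∀ c, ρ' c ≤ r)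
    (hlt : ∀ c, g 1 ≤ c → c ∈ Set.range g) :
    Valid r k ρ' (relabel g P) where
  nested := (nested_relabel hg P).2 h.nested
  count_le c s hs := by
    rw [map_fst_relabel]
    obtain ⟨s', hs', rfl⟩ : ∃ s' ∈ [] :: P.map Prod.snd, s'.map g = s := by
      rw [map_snd_relabel] at hs
      rcases mem_cons.1 hs with rfl | hs
      · exact ⟨[], by simp⟩
      · obtain ⟨s', hs', rfl⟩ := mem_map.1 hs
        exact ⟨s', mem_cons_of_mem _ hs', rfl⟩
    by_cases hc : ∃ d, 1 ≤ d ∧ g d = c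
    · obtain ⟨d, hd, rfl⟩ := hc
      rw [count_map_of_injective _ _ hg.injective, count_map_of_injective _ _ hg.injective, hρ d hd]
      exact h.count_le d s' hs'
    · rw [count_eq_zero_of_not_mem, count_eq_zero_of_not_mem]
      · simpa using hr c
      · intro hmem
        obtain ⟨d, hd, rfl⟩ := mem_map.1 hmem
        refine hc ⟨d, ?_, rfl⟩
        rcases mem_cons.1 hs' with rfl | hs'
        · simp at hd
        · obtain ⟨x, hx, rfl⟩ := mem_map.1 hs'
          exact (hP x hx).2 d hd
      · intro hmem
        obtain ⟨d, hd, rfl⟩ := mem_map.1 hmem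
        obtain ⟨x, hx, rfl⟩ := mem_map.1 hd
        exact hc ⟨_, (hP x hx).1, rfl⟩
  good x hx := by
    obtain ⟨x', hx', rfl⟩ := mem_map.1 hx
    exact (good_map hg k _).2 (h.good x' hx')
  not_inevitable x hx c hc hxc := by
    obtain ⟨x', hx', rfl⟩ := mem_map.1 hx
    have h1 := (hP x' hx').1
    obtain ⟨d, rfl⟩ := hlt c ((hg.le_iff_le.2 h1).trans (le_of_lt hxc))
    have hxd := hg.lt_iff_lt.1 hxc
    rw [hρ d (by omega)] at hc
    have := h.not_inevitable x' hx' d hc hxd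
    rw [← incSub_map hg] at this
    simpa using this

/-- Completions are in bijection if `g` maps the remaining letters onto the remaining letters. -/
theorem comp_relabel {k : ℕ} {g : ℕ → ℕ} (hg : StrictMono g) {ρ ρ' : ℕ → ℕ}
    (P : List (ℕ × List ℕ)) (hρ : ∀ c, ρ (g c) = ρ' c) (h0 : ∀ c, c ∉ Set.range g → ρ c = 0) :
    (Comp k ρ (relabel g P)).ncard = (Comp k ρ' P).ncard := by
  have hinj := map_injective_iff.2 hg.injective
  rw [← Set.ncard_image_of_injective (Comp k ρ' P) hinj]
  congr 1
  have key : ∀ z, z.map g ∈ Comp k ρ (relabel g P) ↔ z ∈ Comp k ρ' P := by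
    intro z
    unfold Comp
    refine and_congr ⟨fun h c => ?_, fun h c => ?_⟩ (and_congr (avoids_map hg k z) ?_)
    · rw [← hρ, ← h, count_map_of_injective _ _ hg.injective]
    · by_cases hc : c ∈ Set.range g
      · obtain ⟨d, rfl⟩ := hc
        rw [count_map_of_injective _ _ hg.injective, h, hρ]
      · rw [h0 c hc, count_eq_zero]
        intro hmem
        obtain ⟨d, -, rfl⟩ := mem_map.1 hmem
        exact hc ⟨d, rfl⟩
    · unfold WordRecurrence.relabel
      rw [forall_mem_map]
      refine forall₂_congr fun x _ => ?_
      rw [filter_gt_map hg, ← map_append, good_map hg]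
  ext z
  constructor
  · intro hz
    have hz' : z ∈ Set.range (List.map g) := by
      rw [Set.range_list_map]
      intro c hc
      by_contra hcr
      have h1 := hz.1 c
      rw [h0 c hcr, count_eq_zero] at h1
      exact h1 hc
    obtain ⟨z, rfl⟩ := hz'
    exact ⟨z, (key z).1 hz, rfl⟩
  · rintro ⟨z, hz, rfl⟩
    exact (key z).2 hz

/-- The active minima and activated sequences of the partial words described by `a` and `σ`. -/
def shift (a : ℕ) (σ : State) : List (ℕ × List ℕ) :=
  relabel (fun c => a + c) (σ.minima.zip σ.seqs)

/-- The condition for a state to describe a partial word, which does not depend on `a`. -/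
structure ValidState (r k : ℕ) (σ : State) : Prop where
  length_eq : σ.minima.length = σ.seqs.length
  minima_mem : ∀ m ∈ σ.minima, 1 ≤ m ∧ m ≤ σ.counts.length
  seqs_mem : ∀ s ∈ σ.seqs, ∀ c ∈ s, 1 ≤ c ∧ c ≤ σ.counts.length
  valid : Valid r k (entry σ.counts) (σ.minima.zip σ.seqs)

theorem strictMono_const_add (a : ℕ) : StrictMono (fun c => a + c) :=
  fun _ _ h => Nat.add_lt_add_left h a

theorem remaining_add (r a : ℕ) (L : List ℕ) {i : ℕ} (hi : 1 ≤ i) :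
    remaining r a L (a + i) = entry L i := by
  unfold remaining
  rw [if_neg (by omega)]
  congr 1
  omega

theorem entry_le_remaining_add (r a : ℕ) (L : List ℕ) (i : ℕ) :
    entry L i ≤ remaining r a L (a + i) := by
  rcases Nat.eq_zero_or_pos i with rfl | hi
  · simp [entry]
  · rw [remaining_add r a L hi]

theorem IsPartialWord.length_eq {r k a : ℕ} {σ : State} {w : List ℕ}
    (h : IsPartialWord r k a σ w) : σ.minima.length = σ.seqs.length := by
  have h1 := congrArg length h.minima_eq
  have h2 := congrArg length h.seqs_eq
  simp only [length_map] at h1 h2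
  omega

theorem IsPartialWord.activeList_eq {r k a : ℕ} {σ : State} {w : List ℕ}
    (h : IsPartialWord r k a σ w) : activeList w = shift a σ := by
  unfold activeList shift relabel
  rw [← zip_map', h.minima_eq, h.seqs_eq, zip_map]
  rfl

theorem fst_mem_of_mem_zip {M : List ℕ} {S : List (List ℕ)} {x : ℕ × List ℕ} (h : x ∈ M.zip S) :
    x.1 ∈ M := (of_mem_zip (a := x.1) (b := x.2) h).1

theorem snd_mem_of_mem_zip {M : List ℕ} {S : List (List ℕ)} {x : ℕ × List ℕ} (h : x ∈ M.zip S) :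
    x.2 ∈ S := (of_mem_zip (a := x.1) (b := x.2) h).2

theorem IsPartialWord.validState {r k a : ℕ} {σ : State} {w : List ℕ}
    (h : IsPartialWord r k a σ w) : ValidState r k σ where
  length_eq := h.length_eq
  minima_mem := h.minima_mem
  seqs_mem := h.seqs_mem
  valid := by
    have hv : Valid r k (remaining r a σ.counts) (activeList w) := by
      refine ⟨nested_activeList w, fun c s hs => ?_, fun x hx => ?_, fun x hx c hc hxc => ?_⟩
      · exact (Nat.add_le_add_right (count_activeList_le w c s hs) _).trans (h.count_le c)
      · obtain ⟨p, hp, hx1, hx2⟩ := exists_mem_of_mem_activeList hx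
        rw [← hx2]
        exact h.good (lt_length_of_mem_activePositions hp)
      · obtain ⟨p, hp, hx1, hx2⟩ := exists_mem_of_mem_activeList hx
        rw [← hx2]
        exact h.not_incSub (lt_length_of_mem_activePositions hp) hc (hx1 ▸ hxc)
    rw [h.activeList_eq] at hv
    exact hv.of_relabel (strictMono_const_add a) (entry_le_remaining_add r a σ.counts)

theorem ValidState.one_le {r k : ℕ} {σ : State} (h : ValidState r k σ) :
    ∀ x ∈ σ.minima.zip σ.seqs, 1 ≤ x.1 ∧ ∀ c ∈ x.2, 1 ≤ c := fun _ hx =>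
  ⟨(h.minima_mem _ (fst_mem_of_mem_zip hx)).1,
    fun c hc => (h.seqs_mem _ (snd_mem_of_mem_zip hx) c hc).1⟩

theorem ValidState.entry_le {r k : ℕ} {σ : State} (h : ValidState r k σ) (i : ℕ) :
    entry σ.counts i ≤ r := by
  have := h.valid.count_le i [] (by simp)
  omega

theorem ValidState.remaining_le {r k : ℕ} {σ : State} (h : ValidState r k σ) (a c : ℕ) :
    remaining r a σ.counts c ≤ r := by
  unfold remaining
  split_ifs
  · exact le_rfl
  · exact h.entry_le _

theorem ValidState.valid_shift {r k : ℕ} {σ : State} (h : ValidState r k σ) (a : ℕ) :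
    Valid r k (remaining r a σ.counts) (shift a σ) :=
  h.valid.relabel (strictMono_const_add a) h.one_le
    (fun _ hc => remaining_add r a σ.counts hc) (h.remaining_le a)
    (fun c hc => ⟨c - a, by simp only at hc ⊢; omega⟩)

theorem map_fst_shift {a : ℕ} {σ : State} (h : σ.minima.length = σ.seqs.length) :
    (shift a σ).map Prod.fst = σ.minima.map (fun m => a + m) := by
  rw [shift, map_fst_relabel, map_fst_zip h.le]

theorem map_snd_shift {a : ℕ} {σ : State} (h : σ.minima.length = σ.seqs.length) :
    (shift a σ).map Prod.snd = σ.seqs.map (List.map (fun c => a + c)) := by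
  rw [shift, map_snd_relabel, map_snd_zip h.ge]

theorem headD_mem {S : List (List ℕ)} : S.headD [] ∈ [] :: S := by
  cases S <;> simp

/-- The word realizing the nested list of a valid state is a partial word; none of its left-to-right
minima is deactivated. -/
theorem ValidState.exists_isPartialWord {r k : ℕ} {σ : State} (h : ValidState r k σ) (a : ℕ) :
    ∃ w, IsPartialWord r k a σ w := by
  have hv := h.valid_shift a
  obtain ⟨w, hw, hcount, hhead⟩ := hv.nested.exists_word
  have hnd : ∀ p, IsLTRMin w p → ¬ IsDeactivated w p := by
    intro p hp hd
    obtain ⟨x, hx, y, hy, hyp⟩ := IsFixed.exists_activeList hd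
    rw [hw] at hx
    rcases w with _ | ⟨m, w⟩
    · simp [IsLTRMin] at hp
    have hpm : (m :: w).getD p 0 ≤ m := by
      rcases Nat.eq_zero_or_pos p with rfl | hp0
      · simp
      · exact hp.2 0 hp0
    rcases hs : shift a σ with _ | ⟨x₀, P⟩
    · rw [hs] at hx; simp at hx
    · rw [hs] at hhead hx hv
      simp only [head?_cons, Option.map_some, Option.some.injEq] at hhead
      have := hv.nested.above x hx y hy x₀ (by simp)
      omega
  have hall : ∀ {G : List ℕ → Prop}, (∀ u v, u <+ v → G v → G u) → ∀ z, AllAbove G z →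
      (∀ x ∈ shift a σ, G (x.2 ++ z.filter (fun c => x.1 < c))) → AllAbove G (w ++ z) := by
    intro G hG z hz hx
    refine allAbove_append hG hz fun p hp hsup => ?_
    rw [← hw] at hx
    refine hx (w.getD p 0, activatedSeq w p) (mem_map.2 ⟨p, ?_, rfl⟩)
    exact mem_filter.2 ⟨mem_range.2 hp.1, by simp [hp, hsup, hnd p hp]⟩
  refine ⟨w, ⟨?_, ?_, h.minima_mem, h.seqs_mem, ?_, ?_, ?_, ?_,
    fun p hp _ hd => absurd hd (hnd p hp)⟩⟩
  · intro c hc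
    by_contra hca
    have hpos := count_pos_iff.2 hc
    rw [hcount, map_fst_shift h.length_eq, map_snd_shift h.length_eq, count_eq_zero_of_not_mem,
      count_eq_zero_of_not_mem] at hpos
    · simp at hpos
    · intro hmem
      rcases hS : σ.seqs with _ | ⟨s, S⟩
      · rw [hS] at hmem; simp at hmem
      · rw [hS] at hmem
        simp only [map_cons, headD_cons, mem_map] at hmem
        obtain ⟨d, hd, rfl⟩ := hmem
        have := h.seqs_mem s (by simp [hS]) d hd
        omega
    · intro hmem
      obtain ⟨d, hd, rfl⟩ := mem_map.1 hmem
      have := h.minima_mem d hd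
      omega
  · intro c
    rw [hcount]
    exact hv.count_le c _ headD_mem
  · rw [← map_fst_shift h.length_eq, ← hw, activeList, map_map]
    rfl
  · rw [← map_snd_shift h.length_eq, ← hw, activeList, map_map]
    rfl
  · rw [avoids_iff, ← append_nil w]
    refine hall (good_closed k) [] (fun _ _ hu => by simp at hu) fun x hx => ?_
    simpa using hv.good x hx
  · intro c hc
    rw [contains_1234_iff, not_not]
    refine hall (not_incSub_closed 3) [c] ?_ fun x hx => ?_
    · intro _ u hu _
      rintro ⟨v, hv, hl, -⟩
      have := hv.length_le
      have := hu.length_le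
      simp only [length_cons, length_nil] at *
      omega
    · by_cases hxc : x.1 < c
      · rw [filter_eq_self.2 (by simpa using hxc)]
        exact hv.not_inevitable x hx c hc.ne' hxc
      · rw [filter_eq_nil_iff.2 (by simpa using hxc), append_nil]
        exact (hv.good x hx).1

theorem exists_isPartialWord_iff {r k a : ℕ} {σ : State} :
    (∃ w, IsPartialWord r k a σ w) ↔ ValidState r k σ :=
  ⟨fun ⟨_, hw⟩ => hw.validState, fun h => h.exists_isPartialWord a⟩

theorem ncard_completions {r k a : ℕ} {σ : State} {w : List ℕ} (h : IsPartialWord r k a σ w) :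
    (completions r k a σ.counts w).ncard =
      (Comp k (remaining r a σ.counts) (shift a σ)).ncard := by
  rw [h.completions_eq, h.activeList_eq]

/-- In particular, `A` does not depend on the choice of the partial word. -/
theorem A_eq {r k : ℕ} {σ : State} (h : ValidState r k σ) (a : ℕ) :
    A r k a σ = (Comp k (remaining r a σ.counts) (shift a σ)).ncard := by
  have hex := h.exists_isPartialWord a
  rw [A, dif_pos hex]
  exact ncard_completions hex.choose_spec

/-! ### The first letter of a completion -/

/-- A minimum with an empty sequence may be forgotten when `c` supersedes it, as the condition at
`c` is stronger. -/
theorem comp_cons_newMin {k c : ℕ} {ρ ρ' : ℕ → ℕ} {P : List (ℕ × List ℕ)} {z : List ℕ}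
    (hρ : (∀ d, (c :: z).count d = ρ d) ↔ ∀ d, z.count d = ρ' d) (hc : ∀ x ∈ P, c ≤ x.1) :
    c :: z ∈ Comp k ρ P ↔ z ∈ Comp k ρ' (appendLetter P c) := by
  have hf : ∀ x ∈ P, (c :: z).filter (fun d => x.1 < d) = z.filter (fun d => x.1 < d) := by
    intro x hx
    exact filter_cons_of_neg (by simpa using hc x hx)
  unfold Comp appendLetter
  rw [if_pos hc, Set.mem_ofPred_eq, Set.mem_ofPred_eq, hρ, avoids_cons]
  refine and_congr_right fun _ => ?_
  constructor
  · rintro ⟨⟨h1, h2⟩, h3⟩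
    refine ⟨h2, fun x hx => ?_⟩
    rcases mem_append.1 hx with hx | hx
    · have := h3 x (mem_of_mem_filter hx)
      rwa [hf x (mem_of_mem_filter hx)] at this
    · simp only [mem_singleton] at hx
      subst hx
      simpa using h1
  · rintro ⟨h2, h3⟩
    have h1 : Good k (z.filter (fun d => c < d)) := by
      simpa using h3 (c, []) (by simp)
    refine ⟨⟨h1, h2⟩, fun x hx => ?_⟩
    rw [hf x hx]
    by_cases hx2 : x.2 = []
    · rw [hx2, nil_append]
      exact h1.mono (filter_lt_sublist_of_le (hc x hx) z)
    · exact h3 x (mem_append_left _ (mem_filter.2 ⟨hx, by simpa using hx2⟩))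

theorem append_filter_cons {c m : ℕ} (h : m < c) (s z : List ℕ) :
    s ++ (c :: z).filter (fun d => m < d) = s ++ [c] ++ z.filter (fun d => m < d) := by
  rw [filter_cons_of_pos (by simpa using h), append_assoc]
  rfl

/-- The minima that `c` deactivates impose no further condition: the letters above them have to
decrease from now on. -/
theorem comp_cons_of_lt {r k c : ℕ} {ρ ρ' : ℕ → ℕ} {P : List (ℕ × List ℕ)} {z : List ℕ}
    (hP : Valid r k ρ P) (hρ : (∀ d, (c :: z).count d = ρ d) ↔ ∀ d, z.count d = ρ' d)
    (hc : ¬ ∀ x ∈ P, c ≤ x.1)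
    (hdec : ∀ x ∈ P, c ≤ x.1 → (∀ d, (c :: z).count d = ρ d) →
      ((c :: z).filter (fun d => x.1 < d)).Pairwise (· ≥ ·) →
      ¬ DecSub (k - 1) (x.2 ++ (c :: z).filter (fun d => x.1 < d))) :
    c :: z ∈ Comp k ρ P ↔ z ∈ Comp k ρ' (appendLetter P c) := by
  unfold Comp appendLetter
  rw [if_neg hc, Set.mem_ofPred_eq, Set.mem_ofPred_eq, ← hρ, avoids_cons, forall_mem_map]
  refine and_congr_right fun hz => ?_
  constructor
  · rintro ⟨⟨h1, h2⟩, h3⟩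
    refine ⟨h2, fun x hx => ?_⟩
    rw [← append_filter_cons (by simpa using of_mem_filter hx)]
    exact h3 x (mem_of_mem_filter hx)
  · rintro ⟨h2, h3⟩
    push Not at hc
    obtain ⟨x₀, hx₀, hc₀⟩ := hc
    have hg := h3 x₀ (mem_filter.2 ⟨hx₀, by simpa using hc₀⟩)
    refine ⟨⟨hg.mono ?_, h2⟩, fun x hx => ?_⟩
    · exact (filter_lt_sublist_of_le hc₀.le z).trans (sublist_append_right _ _)
    · by_cases hxc : x.1 < c
      · rw [append_filter_cons hxc]
        exact h3 x (mem_filter.2 ⟨hx, by simpa using hxc⟩)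
      · have hw : ((c :: z).filter (fun d => x.1 < d)).Pairwise (· ≥ ·) := by
          rw [filter_cons_of_neg (by simpa using hxc)]
          exact weaklyDecreasing_of_good hg (y := c) (by simp) hc₀ (by omega)
        refine ⟨not_incSub_append_of_weaklyDecreasing (hP.good x hx).1 hw fun d hd => ?_,
          hdec x hx (by omega) hz hw⟩
        have hd := mem_filter.1 hd
        refine hP.not_inevitable x hx d ?_ (by simpa using hd.2)
        rw [← hz]
        exact (count_pos_iff.2 hd.1).ne'

/-- After an ascent to `d` and a letter `c > d`, no letter above `c` can follow. -/
theorem le_of_cons_mem_comp {k c : ℕ} {ρ : ℕ → ℕ} {P : List (ℕ × List ℕ)} {z : List ℕ}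
    (hP : Nested P) (hz : c :: z ∈ Comp k ρ P) {x : ℕ × List ℕ} (hx : x ∈ P) {d e : ℕ}
    (hd : d ∈ x.2) (hdc : d < c) (he : ρ e ≠ 0) : e ≤ c := by
  by_contra hec
  have hez : e ∈ z := by
    rw [← hz.1, Nat.ne_zero_iff_zero_lt, count_pos_iff, mem_cons] at he
    exact he.resolve_left (by omega)
  have hxd := hP.above x hx d hd x hx
  refine (hz.2.2 x hx).1 ⟨[d] ++ [c, e], (singleton_sublist.2 hd).append ?_, rfl, ?_⟩
  · rw [filter_cons_of_pos (by simp; omega)]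
    exact (singleton_sublist.2 (mem_filter.2 ⟨hez, by simp; omega⟩)).cons_cons c
  · simp
    omega

/-- Admissibility is what is needed for the extended word not to contain, or make inevitable, a
forbidden pattern. -/
theorem Valid.appendLetter {r k c : ℕ} (hk : 3 ≤ k) {ρ ρ' : ℕ → ℕ} {P : List (ℕ × List ℕ)}
    (hP : Valid r k ρ P) (hc : ρ c ≠ 0) (hρ : ∀ d, ρ' d = if d = c then ρ d - 1 else ρ d)
    (hadm : (∀ x ∈ P, c ≤ x.1) ∨
      (((∀ x ∈ P, ∀ d ∈ x.2, c ≤ d) ∨ ∀ e, ρ e ≠ 0 → e ≤ c) ∧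
        ∀ x ∈ P, x.1 < c → ¬ DecSub (k - 1) (x.2 ++ [c]))) :
    Valid r k ρ' (appendLetter P c) := by
  have hρ' : ∀ d, ρ' d ≠ 0 → ρ d ≠ 0 := by
    intro d hd
    rw [hρ] at hd
    split_ifs at hd <;> omega
  have hcount : ∀ d, ∀ s ∈ [] :: (WordRecurrence.appendLetter P c).map Prod.snd,
      ((WordRecurrence.appendLetter P c).map Prod.fst).count d + s.count d + ρ' d ≤ r := by
    intro d s hs
    have hle : ρ d ≤ r := by
      have := hP.count_le d [] (by simp)
      omega
    have h1 := count_appendLetter_le (d := c) (c := d) (n := r - ρ d) (P := P)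
      (fun s hs => by have := hP.count_le d s hs; omega) s hs
    rw [hρ]
    by_cases hdc : d = c
    · subst hdc
      rw [count_singleton_self] at h1
      rw [if_pos rfl]
      omega
    · rw [count_singleton, if_neg (by simpa using Ne.symm hdc)] at h1
      rw [if_neg hdc]
      omega
  refine ⟨hP.nested.appendLetter c, hcount, ?_, ?_⟩
  · intro x hx
    unfold WordRecurrence.appendLetter at hx
    split_ifs at hx with h
    · rcases mem_append.1 hx with hx | hx
      · exact hP.good x (mem_of_mem_filter hx)
      · simp only [mem_singleton] at hx
        subst hx
        constructor
        · rintro ⟨u, hu, hl, -⟩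
          simp [sublist_nil.1 hu] at hl
        · rintro ⟨u, hu, hl, -⟩
          simp [sublist_nil.1 hu] at hl
          omega
    · obtain ⟨y, hy, rfl⟩ := mem_map.1 hx
      have hyc : y.1 < c := by simpa using of_mem_filter hy
      have hy := mem_of_mem_filter hy
      exact ⟨hP.not_inevitable y hy c hc hyc, (hadm.resolve_left h).2 y hy hyc⟩
  · intro x hx e he hxe
    have he := hρ' e he
    unfold WordRecurrence.appendLetter at hx
    split_ifs at hx with h
    · rcases mem_append.1 hx with hx | hx
      · exact hP.not_inevitable x (mem_of_mem_filter hx) e he hxe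
      · simp only [mem_singleton] at hx
        subst hx
        rintro ⟨u, hu, hl, -⟩
        have := hu.length_le
        simp at this
        omega
    · obtain ⟨y, hy, rfl⟩ := mem_map.1 hx
      have hyc : y.1 < c := by simpa using of_mem_filter hy
      have hy := mem_of_mem_filter hy
      have h1 := hP.not_inevitable y hy c hc hyc
      have h2 := hP.not_inevitable y hy e he hxe
      rw [append_assoc]
      change ¬ IncSub 3 (y.2 ++ [c, e])
      by_cases hce : e ≤ c
      · refine not_incSub_append_of_weaklyDecreasing (hP.good y hy).1 (by simpa using hce) ?_
        simp [h1, h2]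
      · have hle : ∀ d ∈ y.2, c ≤ d :=
          ((hadm.resolve_left h).1.resolve_right fun h' => hce (h' e he)) y hy
        rintro ⟨u, hu, hl, hp⟩
        obtain ⟨u₁, u₂, rfl, hu1, hu2⟩ := sublist_append_iff.1 hu
        rcases u₁ with _ | ⟨d, u₁⟩
        · have := hu2.length_le
          simp at this hl
          omega
        · -- a letter of the old sequence followed by `c` is not an ascent
          have hcu : c ∉ u₂ := by
            intro hcu
            have hdc := (pairwise_cons.1 hp).1 c (mem_append_right _ hcu)
            exact absurd (hle d (hu1.subset (by simp))) (by omega)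
          have hu3 : u₂ <+ [e] := by
            rcases sublist_cons_iff.1 hu2 with h' | ⟨u', rfl, -⟩
            · exact h'
            · simp at hcu
          exact h2 ⟨_, hu1.append hu3, hl, hp⟩

theorem appendLetter_relabel {g : ℕ → ℕ} (hg : StrictMono g) (P : List (ℕ × List ℕ)) (c : ℕ) :
    appendLetter (relabel g P) (g c) = relabel g (appendLetter P c) := by
  have h : (∀ x ∈ relabel g P, g c ≤ x.1) ↔ ∀ x ∈ P, c ≤ x.1 := by
    unfold relabel
    rw [forall_mem_map]
    simp only [hg.le_iff_le]
  unfold appendLetter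
  simp only [h]
  split_ifs
  · simp only [relabel, map_append, filter_map, map_cons, map_nil]
    congr 2
    apply filter_congr
    simp
  · simp only [relabel, filter_map, map_map]
    have : filter ((fun x : ℕ × List ℕ => decide (x.1 < g c)) ∘ fun x => (g x.1, map g x.2)) P =
        filter (fun x => decide (x.1 < c)) P := by
      apply filter_congr
      simp [hg.lt_iff_lt]
    rw [this]
    apply map_congr_left
    simp

/-! ### Adding a letter to a state -/

/-- As the minima decrease, those not below `i` form an initial segment. -/
theorem dropWhile_eq_filter {P : List (ℕ × List ℕ)} (hP : P.Pairwise (fun x y => y.1 ≤ x.1))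
    (i : ℕ) : P.dropWhile (fun x => i ≤ x.1) = P.filter (fun x => x.1 < i) := by
  induction P with
  | nil => rfl
  | cons x P ih =>
    rw [pairwise_cons] at hP
    by_cases h : i ≤ x.1
    · rw [dropWhile_cons_of_pos (by simpa using h), filter_cons_of_neg (by simpa using h), ih hP.2]
    · rw [dropWhile_cons_of_neg (by simpa using h), filter_eq_self.2]
      intro y hy
      rcases mem_cons.1 hy with rfl | hy
      · simpa using h
      · have := hP.1 y hy
        simp
        omega

theorem Nested.filter_ne_nil {P : List (ℕ × List ℕ)} (hP : Nested P) :
    P.filter (fun x => x.2 ≠ []) =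
      if (P.map Prod.snd).getLast? = some [] then P.dropLast else P := by
  rcases eq_nil_or_concat' P with rfl | ⟨P, ⟨m, s⟩, rfl⟩
  · simp
  · have h1 := (pairwise_append.1 hP.chain).2.2
    have h2 : P.filter (fun x => x.2 ≠ []) = P := by
      rw [filter_eq_self]
      intro x hx
      obtain ⟨-, h3, h4⟩ := h1 x hx (m, s) (by simp)
      simp only [ne_eq, decide_not, Bool.not_eq_eq_eq_not, Bool.not_true, decide_eq_false_iff_not]
      intro e
      rw [e, suffix_nil] at h3
      exact h4 (h3.trans e.symm)
    rw [filter_append, h2]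
    by_cases hs : s = [] <;> simp [hs]

/-- The definition of `addLetter` removes an initial segment or the last entry; on nested lists
this is the filtering of `appendLetter`. -/
theorem addLetter_eq {σ : State} (hlen : σ.minima.length = σ.seqs.length)
    (hP : Nested (σ.minima.zip σ.seqs)) (i : ℕ) :
    addLetter σ i = ⟨(appendLetter (σ.minima.zip σ.seqs) i).map Prod.fst,
      (appendLetter (σ.minima.zip σ.seqs) i).map Prod.snd, reduce σ.counts i⟩ := by
  obtain ⟨M, S, L⟩ := σ
  simp only at hlen hP ⊢
  have hM : M = (M.zip S).map Prod.fst := (map_fst_zip hlen.le).symm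
  have hS : S = (M.zip S).map Prod.snd := (map_snd_zip hlen.ge).symm
  generalize hZ : M.zip S = P at *
  subst hM hS
  unfold addLetter appendLetter
  simp only [hZ, forall_mem_map]
  split_ifs with h1 h2
  · rw [hP.filter_ne_nil, if_pos h2]
    simp [map_dropLast]
  · rw [hP.filter_ne_nil, if_neg h2]
    simp
  · rw [dropWhile_eq_filter (hP.chain.imp (fun h => h.1))]
    simp [Function.comp_def]

theorem zip_map_fst_snd (P : List (ℕ × List ℕ)) : (P.map Prod.fst).zip (P.map Prod.snd) = P := by
  rw [zip_map']
  simp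

theorem addLetter_zip {σ : State} (hlen : σ.minima.length = σ.seqs.length)
    (hP : Nested (σ.minima.zip σ.seqs)) (i : ℕ) :
    (addLetter σ i).minima.zip (addLetter σ i).seqs = appendLetter (σ.minima.zip σ.seqs) i := by
  rw [addLetter_eq hlen hP]
  exact zip_map_fst_snd _

theorem one_le_of_entry_ne_zero {L : List ℕ} {i : ℕ} (h : entry L i ≠ 0) : 1 ≤ i := by
  by_contra h'
  have : i = 0 := by omega
  exact h (by simp [entry, this])

theorem le_length_of_entry_ne_zero {L : List ℕ} {i : ℕ} (h : entry L i ≠ 0) : i ≤ L.length := by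
  by_contra h'
  exact h (entry_eq_zero_of_length_lt (by omega))

theorem length_reduce (L : List ℕ) (i : ℕ) : (reduce L i).length = L.length := by
  simp [reduce]

theorem entry_reduce (L : List ℕ) {i : ℕ} (hi : 1 ≤ i) (j : ℕ) :
    entry (reduce L i) j = if j = i then entry L j - 1 else entry L j := by
  unfold entry reduce
  by_cases hj : j = 0
  · subst hj
    simp
  · rw [if_neg hj, if_neg hj, getD_eq_getElem?_getD, getD_eq_getElem?_getD, getElem?_modify]
    by_cases hij : i = j
    · subst hij
      cases L[i - 1]? <;> simp
    · have : ¬ i - 1 = j - 1 := by omega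
      rw [if_neg (Ne.symm hij)]
      simp [this]

theorem mem_appendLetter {P : List (ℕ × List ℕ)} {c : ℕ} {x : ℕ × List ℕ}
    (hx : x ∈ appendLetter P c) :
    (x.1 = c ∨ x.1 ∈ P.map Prod.fst) ∧ ∀ d ∈ x.2, d = c ∨ ∃ y ∈ P, d ∈ y.2 := by
  unfold appendLetter at hx
  split_ifs at hx
  · rcases mem_append.1 hx with hx | hx
    · have hx := mem_of_mem_filter hx
      exact ⟨Or.inr (mem_map_of_mem hx), fun d hd => Or.inr ⟨x, hx, hd⟩⟩
    · simp only [mem_singleton] at hx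
      subst hx
      simp
  · obtain ⟨y, hy, rfl⟩ := mem_map.1 hx
    have hy := mem_of_mem_filter hy
    refine ⟨Or.inr (mem_map.2 ⟨y, hy, rfl⟩), fun d hd => ?_⟩
    rcases mem_append.1 hd with hd | hd
    · exact Or.inr ⟨y, hy, hd⟩
    · exact Or.inl (by simpa using hd)

theorem fix_shift (r a m : ℕ) (s L : List ℕ) :
    fix (a + m) (s.map (fun c => a + c)) (replicate a r ++ L) =
      (fix m s L).map (fun c => a + c) := by
  unfold fix
  have h1 : (replicate a r ++ L).length - (a + m) = L.length - m := by
    simp only [length_append, length_replicate]; omega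
  have h2 : range' (a + m + 1) (L.length - m) =
      (range' (m + 1) (L.length - m)).map (fun c => a + c) := by
    rw [map_add_range']; rfl
  rw [map_append, h1, h2, ← map_reverse, flatMap_map, map_flatMap]
  congr 1
  apply flatMap_congr
  intro j hj
  simp only [mem_reverse, mem_range'_1] at hj
  rw [entry_replicate_append, remaining_add _ _ _ (by omega), map_replicate]

/-- The arrangement in `fix` is the one in which a word of the remaining letters has to continue
above a deactivated minimum. -/
theorem contains_fix_iff {r k a m : ℕ} {s L z : List ℕ}
    (hz : ∀ c, z.count c = remaining r a L c)
    (hw : (z.filter (fun c => a + m < c)).Pairwise (· ≥ ·)) :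
    Contains (fix m s L) (patternDesc k) ↔
      DecSub (k - 1) (s.map (fun c => a + c) ++ z.filter (fun c => a + m < c)) := by
  rw [contains_patternDesc_iff, ← decSub_map (strictMono_const_add a), ← fix_shift r,
    fix_eq_append _ hw]
  intro c
  rw [count_filter_lt hz, entry_replicate_append]

theorem ValidState.mem_headD {r k : ℕ} {σ : State} (h : ValidState r k σ) {x : ℕ × List ℕ}
    (hx : x ∈ σ.minima.zip σ.seqs) : ∀ c ∈ x.2, c ∈ σ.seqs.headD [] := by
  have hN := h.valid.nested.chain
  have hS : σ.seqs = (σ.minima.zip σ.seqs).map Prod.snd := (map_snd_zip h.length_eq.ge).symm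
  rw [hS]
  generalize σ.minima.zip σ.seqs = P at *
  rcases P with _ | ⟨y, P⟩
  · simp at hx
  · intro c hc
    rcases mem_cons.1 hx with rfl | hx
    · simpa using hc
    · simpa using ((pairwise_cons.1 hN).1 x hx).2.1.subset hc

theorem ValidState.forall_headD_iff {r k : ℕ} {σ : State} (h : ValidState r k σ) {p : ℕ → Prop} :
    (∀ c ∈ σ.seqs.headD [], p c) ↔ ∀ x ∈ σ.minima.zip σ.seqs, ∀ c ∈ x.2, p c := by
  refine ⟨fun h' x hx c hc => h' c (h.mem_headD hx c hc), fun h' => ?_⟩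
  have hS : σ.seqs = (σ.minima.zip σ.seqs).map Prod.snd := (map_snd_zip h.length_eq.ge).symm
  rw [hS]
  generalize σ.minima.zip σ.seqs = P at *
  rcases P with _ | ⟨y, P⟩
  · simp
  · simpa using h' y (by simp)

theorem ValidState.forall_minima_iff {r k : ℕ} {σ : State} (h : ValidState r k σ) {p : ℕ → Prop} :
    (∀ m ∈ σ.minima, p m) ↔ ∀ x ∈ σ.minima.zip σ.seqs, p x.1 := by
  conv_lhs => rw [← map_fst_zip h.length_eq.le]
  rw [forall_mem_map]

theorem forall_largest_iff {L : List ℕ} {i : ℕ} :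
    (∀ j ∈ Finset.Icc 1 L.length, entry L j ≠ 0 → j ≤ i) ↔ ∀ j, entry L j ≠ 0 → j ≤ i :=
  ⟨fun h j hj => h j (Finset.mem_Icc.2 ⟨one_le_of_entry_ne_zero hj, le_length_of_entry_ne_zero hj⟩)
    hj, fun h j _ hj => h j hj⟩

theorem ValidState.addLetter {r k i : ℕ} (hk : 3 ≤ k) {σ : State} (h : ValidState r k σ)
    (hi : entry σ.counts i ≠ 0) (hadm : Admissible k σ i) : ValidState r k (addLetter σ i) := by
  have h1 := one_le_of_entry_ne_zero hi
  have h2 := le_length_of_entry_ne_zero hi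
  have hv : Valid r k (entry (reduce σ.counts i)) (appendLetter (σ.minima.zip σ.seqs) i) := by
    refine h.valid.appendLetter hk hi (entry_reduce _ h1) ?_
    unfold Admissible at hadm
    rw [h.forall_headD_iff, h.forall_minima_iff, forall_largest_iff] at hadm
    refine hadm.imp_right (And.imp_right fun h' x hx hxi => ?_)
    rw [← contains_patternDesc_iff]
    exact (h' x hx).2 hxi
  rw [addLetter_eq h.length_eq h.valid.nested]
  refine ⟨by simp, ?_, ?_, by rwa [zip_map_fst_snd]⟩
  · simp only [forall_mem_map, length_reduce]
    intro x hx
    rcases (mem_appendLetter hx).1 with hx | hx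
    · rw [hx]; exact ⟨h1, h2⟩
    · rw [map_fst_zip h.length_eq.le] at hx
      exact h.minima_mem _ hx
  · simp only [forall_mem_map, length_reduce]
    intro x hx c hc
    rcases (mem_appendLetter hx).2 c hc with rfl | ⟨y, hy, hc⟩
    · exact ⟨h1, h2⟩
    · exact h.seqs_mem _ (snd_mem_of_mem_zip hy) c hc

theorem shift_addLetter {r k : ℕ} {σ : State} (h : ValidState r k σ) (a i : ℕ) :
    shift a (addLetter σ i) = appendLetter (shift a σ) (a + i) := by
  unfold shift
  rw [addLetter_zip h.length_eq h.valid.nested,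
    ← appendLetter_relabel (strictMono_const_add a)]

theorem remaining_reduce (r a : ℕ) (L : List ℕ) {i : ℕ} (hi : 1 ≤ i) (c : ℕ) :
    remaining r a (reduce L i) c =
      if c = a + i then remaining r a L c - 1 else remaining r a L c := by
  unfold remaining
  split_ifs with h1 h2 h2
  · omega
  · rfl
  · rw [entry_reduce _ hi, if_pos (by omega)]
  · rw [entry_reduce _ hi]
    split_ifs
    · have h0 : c - a = i := by assumption
      omega
    · rfl

theorem count_cons_iff {r a i : ℕ} {L : List ℕ} (hi : entry L i ≠ 0) (z : List ℕ) :
    (∀ d, ((a + i) :: z).count d = remaining r a L d) ↔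
      ∀ d, z.count d = remaining r a (reduce L i) d := by
  have h1 := one_le_of_entry_ne_zero hi
  refine forall_congr' fun d => ?_
  rw [remaining_reduce _ _ _ h1, count_cons]
  by_cases hd : d = a + i
  · subst hd
    rw [remaining_add _ _ _ h1]
    simp
    omega
  · have : ¬ a + i = d := fun e => hd e.symm
    simp [hd, this]

/-- An admissible letter `a + i` is followed by the completions of the extended word. -/
theorem cons_mem_comp_iff {r k a i : ℕ} {σ : State} (h : ValidState r k σ)
    (hi : entry σ.counts i ≠ 0) (hadm : Admissible k σ i) (z : List ℕ) :
    (a + i) :: z ∈ Comp k (remaining r a σ.counts) (shift a σ) ↔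
      z ∈ Comp k (remaining r a (addLetter σ i).counts) (shift a (addLetter σ i)) := by
  have hcount := count_cons_iff (r := r) (a := a) hi z
  have hcounts : (addLetter σ i).counts = reduce σ.counts i := by
    rw [addLetter_eq h.length_eq h.valid.nested]
  rw [shift_addLetter h, hcounts]
  by_cases hc : ∀ x ∈ shift a σ, a + i ≤ x.1
  · exact comp_cons_newMin hcount hc
  · refine comp_cons_of_lt (h.valid_shift a) hcount hc fun x hx hxi hz hw => ?_
    obtain ⟨x, hx', rfl⟩ := mem_map.1 hx
    have hnot : ¬ ∀ m ∈ σ.minima, i ≤ m := by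
      rw [h.forall_minima_iff]
      intro h'
      refine hc fun y hy => ?_
      obtain ⟨y, hy', rfl⟩ := mem_map.1 hy
      have := h' y hy'
      simp only
      omega
    rw [← contains_fix_iff hz hw]
    exact ((hadm.resolve_left hnot).2 x hx').1 (by simp only at hxi; omega)

/-- The first letter of a completion is admissible. -/
theorem admissible_of_cons_mem_comp {r k a i : ℕ} {σ : State} (h : ValidState r k σ)
    {z : List ℕ} (hz : (a + i) :: z ∈ Comp k (remaining r a σ.counts) (shift a σ)) :
    Admissible k σ i := by
  unfold Admissible
  rw [h.forall_headD_iff, h.forall_minima_iff, forall_largest_iff]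
  by_cases hc : ∀ x ∈ σ.minima.zip σ.seqs, i ≤ x.1
  · exact Or.inl hc
  · right
    have hmem : ∀ x ∈ σ.minima.zip σ.seqs,
        (a + x.1, x.2.map (fun c => a + c)) ∈ shift a σ := fun x hx => mem_map_of_mem hx
    refine ⟨?_, fun x hx => ⟨fun hxi hcon => ?_, fun hxi hcon => ?_⟩⟩
    · by_contra! hcon
      obtain ⟨⟨x, hx, d, hd, hdi⟩, j, hj, hij⟩ := hcon
      have := le_of_cons_mem_comp (h.valid_shift a).nested hz (hmem x hx) (mem_map_of_mem hd)
        (by omega) (e := a + j) (by rwa [remaining_add _ _ _ (one_le_of_entry_ne_zero hj)])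
      omega
    · push Not at hc
      obtain ⟨y, hy, hyi⟩ := hc
      have hg := hz.2.2 _ (hmem y hy)
      rw [append_filter_cons (by simpa using hyi)] at hg
      have hw := weaklyDecreasing_of_good (m := a + x.1) hg (y := a + i) (by simp)
        (by simpa using hyi) (by omega)
      rw [← filter_cons_of_neg (a := a + i) (by simpa using hxi)] at hw
      rw [contains_fix_iff hz.1 hw] at hcon
      exact (hz.2.2 _ (hmem x hx)).2 hcon
    · rw [contains_patternDesc_iff, ← decSub_map (strictMono_const_add a)] at hcon
      have hg := hz.2.2 _ (hmem x hx)
      rw [append_filter_cons (by simpa using hxi)] at hg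
      refine hg.2 (hcon.mono ?_)
      rw [map_append]
      exact sublist_append_left _ _

/-! ### Bounds and finiteness -/

theorem entry_succ (L : List ℕ) (i : ℕ) : entry L (i + 1) = L.getD i 0 := by
  simp [entry]

theorem ValidState.counts_le {r k : ℕ} {σ : State} (h : ValidState r k σ) :
    ∀ l ∈ σ.counts, l ≤ r := by
  intro l hl
  obtain ⟨i, hi, rfl⟩ := exists_getD_of_mem hl
  rw [← entry_succ]
  exact h.entry_le _

theorem ValidState.good_of_mem_seqs {r k : ℕ} {σ : State} (h : ValidState r k σ) :
    ∀ s ∈ σ.seqs, Good k s := by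
  rw [← map_snd_zip h.length_eq.ge, forall_mem_map]
  exact h.valid.good

theorem ValidState.length_seq_le {r k : ℕ} (hk : 3 ≤ k) {σ : State} (h : ValidState r k σ) :
    ∀ s ∈ σ.seqs, s.length ≤ 2 * r * (k - 2) := by
  intro s hs
  have hs' : s ∈ [] :: (σ.minima.zip σ.seqs).map Prod.snd := by
    rw [map_snd_zip h.length_eq.ge]
    exact mem_cons_of_mem _ hs
  have h1 := length_le_of_count_le (r := r) s (fun c => by
    have := h.valid.count_le c s hs'
    omega)
  have h2 := Nat.mul_le_mul_right r ((h.good_of_mem_seqs s hs).card_toFinset_le hk)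
  calc s.length ≤ 2 * (k - 2) * r := h1.trans h2
    _ = 2 * r * (k - 2) := by ring

theorem length_le_of_decreasing {l : List ℕ} {n : ℕ} (h : l.Pairwise (· > ·))
    (hn : ∀ x ∈ l, x ≤ n) : l.length ≤ n + 1 := by
  have hnd : l.Nodup := h.imp (fun h => h.ne')
  rw [← toFinset_card_of_nodup hnd, ← Finset.card_range (n + 1)]
  refine Finset.card_le_card fun x hx => ?_
  have := hn x (mem_toFinset.1 hx)
  exact Finset.mem_range.2 (by omega)

/-- The activated sequences have distinct lengths, so that there are not many of them. -/
theorem ValidState.length_minima_le {r k : ℕ} (hk : 3 ≤ k) {σ : State} (h : ValidState r k σ) :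
    σ.minima.length ≤ 2 * r * (k - 2) + 1 := by
  have hlen : σ.minima.length = ((σ.minima.zip σ.seqs).map (fun x => x.2.length)).length := by
    rw [length_map, length_zip, h.length_eq, min_self]
  rw [hlen]
  refine length_le_of_decreasing ?_ ?_
  · rw [pairwise_map]
    exact h.valid.nested.chain.imp fun ⟨_, h2, h3⟩ =>
      lt_of_le_of_ne h2.length_le fun e => h3 (h2.eq_of_length e)
  · rw [forall_mem_map]
    exact fun x hx => h.length_seq_le hk _ (snd_mem_of_mem_zip hx)

theorem finite_lists_of_length_le {α : Type*} {s : Set α} (hs : s.Finite) (n : ℕ) :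
    {l : List α | l.length ≤ n ∧ ∀ x ∈ l, x ∈ s}.Finite := by
  have := hs.to_subtype
  refine ((List.finite_length_le s n).image (List.map Subtype.val)).subset ?_
  rintro l ⟨hl, hmem⟩
  have hl' : l ∈ Set.range (List.map ((↑) : s → α)) := by
    rw [Set.range_list_map_coe]
    exact hmem
  obtain ⟨l, rfl⟩ := hl'
  exact ⟨l, by simpa using hl, rfl⟩

theorem finite_validState {r k : ℕ} (hk : 3 ≤ k) (t : ℕ) :
    {σ : State | σ.counts.length = t ∧ ValidState r k σ}.Finite := by
  have h1 := finite_lists_of_length_le (Set.finite_Iic t) (2 * r * (k - 2) + 1)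
  have h2 := finite_lists_of_length_le
    (finite_lists_of_length_le (Set.finite_Iic t) (2 * r * (k - 2))) (2 * r * (k - 2) + 1)
  have h3 := finite_lists_of_length_le (Set.finite_Iic r) t
  refine ((h1.prod (h2.prod h3)).image (fun x => State.mk x.1 x.2.1 x.2.2)).subset ?_
  rintro ⟨M, S, L⟩ ⟨hL, h⟩
  refine ⟨(M, S, L), ⟨⟨h.length_minima_le hk, fun m hm => ?_⟩, ⟨?_, fun s hs =>
    ⟨h.length_seq_le hk s hs, fun c hc => ?_⟩⟩, hL.le, h.counts_le⟩, rfl⟩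
  · exact hL ▸ (h.minima_mem m hm).2
  · exact h.length_eq ▸ h.length_minima_le hk
  · exact hL ▸ (h.seqs_mem s hs c hc).2

/-! ### The first letter is among the largest remaining ones -/

/-- The remaining letters above the first letter of a completion all follow it. -/
theorem card_le_of_cons_mem_comp {k c : ℕ} (hk : 3 ≤ k) {ρ : ℕ → ℕ} {P : List (ℕ × List ℕ)}
    {z : List ℕ} (hz : c :: z ∈ Comp k ρ P) {F : Finset ℕ} (hF : ∀ d ∈ F, c < d ∧ ρ d ≠ 0) :
    F.card ≤ 2 * (k - 2) := by
  refine le_trans (Finset.card_le_card ?_) (((avoids_cons _ _ _).1 hz.2.1).1.card_toFinset_le hk)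
  intro d hd
  obtain ⟨h1, h2⟩ := hF d hd
  rw [← hz.1, Nat.ne_zero_iff_zero_lt, count_pos_iff, mem_cons] at h2
  rw [mem_toFinset, mem_filter]
  exact ⟨h2.resolve_left (by omega), by simpa using h1⟩

theorem mem_irrelevant {σ : State} {j : ℕ} : j ∈ irrelevant σ ↔ (1 ≤ j ∧ j ≤ σ.counts.length) ∧
    entry σ.counts j = 0 ∧ j ∉ σ.minima ∧ ∀ s ∈ σ.seqs, j ∉ s := by
  unfold irrelevant
  rw [mem_filter, mem_range'_1, decide_eq_true_eq]
  refine and_congr_left fun _ => ?_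
  omega

/-- If no letter is irrelevant, then the letters without remaining copies occur among the minima
or in the first sequence. The value of `tlen` is chosen so that enough other letters are left. -/
theorem card_entry_ne_zero {r k : ℕ} (hk : 3 ≤ k) {σ : State} (h : ValidState r k σ)
    (hlen : σ.counts.length = tlen r k) (hirr : irrelevant σ = []) :
    2 * (k - 2) < ((Finset.Icc 1 σ.counts.length).filter (fun j => entry σ.counts j ≠ 0)).card := by
  have h1 := Finset.card_filter_add_card_filter_not (s := Finset.Icc 1 σ.counts.length)
    (fun j => entry σ.counts j ≠ 0)
  have h2 : (Finset.Icc 1 σ.counts.length).filter (fun j => ¬ entry σ.counts j ≠ 0) ⊆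
      σ.minima.toFinset ∪ (σ.seqs.headD []).toFinset := by
    intro j hj
    rw [Finset.mem_filter, Finset.mem_Icc, not_not] at hj
    rw [Finset.mem_union, mem_toFinset, mem_toFinset]
    by_contra hcon
    push Not at hcon
    have hmem : j ∈ irrelevant σ := by
      refine mem_irrelevant.2 ⟨hj.1, hj.2, hcon.1, ?_⟩
      rw [← map_snd_zip h.length_eq.ge, forall_mem_map]
      exact fun x hx hjx => hcon.2 (h.mem_headD hx j hjx)
    rw [hirr] at hmem
    simp at hmem
  have h3 : (σ.seqs.headD []).toFinset.card ≤ 2 * (k - 2) := by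
    rcases hS : σ.seqs with _ | ⟨s, S⟩
    · simp
    · exact (h.good_of_mem_seqs s (by simp [hS])).card_toFinset_le hk
  have h4 := (Finset.card_le_card h2).trans (Finset.card_union_le _ _)
  have h5 := h.length_minima_le hk
  have h6 := toFinset_card_le σ.minima
  rw [Nat.card_Icc, hlen, tlen] at h1
  rw [hlen] at h4 ⊢
  have h7 : (2 * r + 4) * (k - 2) = 2 * r * (k - 2) + 2 * (k - 2) + 2 * (k - 2) := by ring
  unfold tlen at *
  omega

theorem exists_choice_of_cons_mem_comp {r k a c : ℕ} (hk : 3 ≤ k) {σ : State}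
    (h : ValidState r k σ) (hlen : σ.counts.length = tlen r k) (hirr : 0 < a → irrelevant σ = [])
    {z : List ℕ} (hz : c :: z ∈ Comp k (remaining r a σ.counts) (shift a σ)) :
    ∃ i ∈ choices k σ, c = a + i := by
  have hc : remaining r a σ.counts c ≠ 0 := by
    rw [← hz.1]
    simp
  -- an unlisted letter would lie below all the listed ones, of which there are too many
  have hac : a < c := by
    by_contra hca
    have h1 : 1 ≤ c := by
      by_contra h0
      have : c = 0 := by omega
      subst this
      simp [remaining, entry] at hc
    have h2 := card_entry_ne_zero hk h hlen (hirr (by omega))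
    have h3 := card_le_of_cons_mem_comp hk hz (F := ((Finset.Icc 1 σ.counts.length).filter
      (fun j => entry σ.counts j ≠ 0)).map (addLeftEmbedding a)) (by
        intro d hd
        obtain ⟨j, hj, rfl⟩ := Finset.mem_map.1 hd
        rw [Finset.mem_filter, Finset.mem_Icc] at hj
        rw [addLeftEmbedding_apply, remaining_add _ _ _ hj.1.1]
        exact ⟨by omega, hj.2⟩)
    rw [Finset.card_map] at h3
    omega
  obtain ⟨i, rfl⟩ : ∃ i, c = a + i := ⟨c - a, by omega⟩
  rw [remaining_add _ _ _ (by omega)] at hc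
  refine ⟨i, Finset.mem_filter.2 ⟨Finset.mem_Icc.2 ⟨one_le_of_entry_ne_zero hc,
    le_length_of_entry_ne_zero hc⟩, hc, ?_, admissible_of_cons_mem_comp h hz⟩, rfl⟩
  have h3 := card_le_of_cons_mem_comp hk hz (F := ((Finset.Icc (i + 1) σ.counts.length).filter
    (fun j => entry σ.counts j ≠ 0)).map (addLeftEmbedding a)) (by
      intro d hd
      obtain ⟨j, hj, rfl⟩ := Finset.mem_map.1 hd
      rw [Finset.mem_filter, Finset.mem_Icc] at hj
      rw [addLeftEmbedding_apply, remaining_add _ _ _ (by omega)]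
      exact ⟨by omega, hj.2⟩)
  rwa [Finset.card_map] at h3

theorem mem_choices {k : ℕ} {σ : State} {i : ℕ} (hi : i ∈ choices k σ) :
    entry σ.counts i ≠ 0 ∧ Admissible k σ i :=
  ⟨(Finset.mem_filter.1 hi).2.1, (Finset.mem_filter.1 hi).2.2.2⟩

theorem finite_comp (k : ℕ) (ρ : ℕ → ℕ) (P : List (ℕ × List ℕ)) : (Comp k ρ P).Finite := by
  rcases (Comp k ρ P).eq_empty_or_nonempty with h | ⟨z₀, h₀⟩
  · rw [h]; exact Set.finite_empty
  · refine (z₀.permutations.toFinset.finite_toSet).subset fun z hz => ?_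
    rw [Finset.mem_coe, mem_toFinset, mem_permutations, perm_iff_count]
    intro c
    rw [hz.1, h₀.1]

theorem ncard_eq_sum_cons {I : Finset ℕ} {a : ℕ} {S : Set (List ℕ)} {T : ℕ → Set (List ℕ)}
    (hS : S.Finite) (hnil : [] ∉ S) (hI : ∀ c z, c :: z ∈ S → ∃ i ∈ I, c = a + i)
    (hT : ∀ i ∈ I, ∀ z, (a + i) :: z ∈ S ↔ z ∈ T i) : S.ncard = ∑ i ∈ I, (T i).ncard := by
  have h1 : ∀ i ∈ I, (cons (a + i) '' T i) ⊆ S := by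
    rintro i hi _ ⟨z, hz, rfl⟩
    exact (hT i hi z).2 hz
  have h2 : S = ⋃ i ∈ I, cons (a + i) '' T i := by
    refine Set.Subset.antisymm ?_ (Set.iUnion₂_subset h1)
    intro z hz
    rcases z with _ | ⟨c, z⟩
    · exact absurd hz hnil
    · obtain ⟨i, hi, rfl⟩ := hI c z hz
      exact Set.mem_biUnion hi ⟨z, (hT i hi z).1 hz, rfl⟩
  have h3 : ∀ i, (T i).ncard = (cons (a + i) '' T i).ncard := fun i =>
    (Set.ncard_image_of_injective _ cons_injective).symm
  simp only [h3]
  rw [← finsum_mem_coe_finset, ← I.finite_toSet.ncard_biUnion]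
  · simp only [Finset.mem_coe]; rw [← h2]
  · exact fun i hi => hS.subset (h1 i hi)
  · intro i _ j _ hij
    rw [Function.onFun, Set.disjoint_left]
    rintro _ ⟨z, -, rfl⟩ ⟨z', -, h⟩
    simp only [cons.injEq] at h
    omega

/-! ### Removing irrelevant letters -/

/-- The increasing enumeration of the natural numbers other than `b`. -/
def skip (b c : ℕ) : ℕ := if c < b then c else c + 1

theorem strictMono_skip (b : ℕ) : StrictMono (skip b) := by
  intro c d h
  unfold skip
  split_ifs <;> omega

theorem mem_range_skip {b c : ℕ} (h : c ≠ b) : c ∈ Set.range (skip b) := by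
  rcases lt_or_gt_of_ne h with h | h
  · exact ⟨c, if_pos h⟩
  · refine ⟨c - 1, ?_⟩
    unfold skip
    rw [if_neg (by omega)]
    omega

theorem getD_eraseIdx (L : List ℕ) (i j : ℕ) :
    (L.eraseIdx i).getD j 0 = if j < i then L.getD j 0 else L.getD (j + 1) 0 := by
  rw [getD_eq_getElem?_getD, getElem?_eraseIdx]
  split_ifs <;> rw [getD_eq_getElem?_getD]

theorem entry_zero (L : List ℕ) : entry L 0 = 0 := by simp [entry]

theorem entry_cons_succ (x : ℕ) (L : List ℕ) (i : ℕ) (hi : 1 ≤ i) :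
    entry (x :: L) (i + 1) = entry L i := by
  unfold entry
  rw [if_neg (by omega), if_neg (by omega)]
  obtain ⟨j, rfl⟩ : ∃ j, i = j + 1 := ⟨i - 1, by omega⟩
  simp

theorem entry_cons_one (x : ℕ) (L : List ℕ) : entry (x :: L) 1 = x := by simp [entry]

theorem entry_cons_eraseIdx (x : ℕ) (L : List ℕ) {j c : ℕ} (hj : 1 ≤ j) (hc : 2 ≤ c) :
    entry (x :: L.eraseIdx (j - 1)) c = if c ≤ j then entry L (c - 1) else entry L c := by
  obtain ⟨c, rfl⟩ : ∃ d, c = d + 2 := ⟨c - 2, by omega⟩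
  rw [entry_cons_succ _ _ _ (by omega), entry_succ, getD_eraseIdx]
  split_ifs with h1 h2 h2
  · simp [entry]
  · omega
  · omega
  · simp [entry]

theorem remaining_succ (r a : ℕ) (L : List ℕ) (c : ℕ) :
    remaining r (a + 1) L c = remaining r a (r :: L) c := by
  unfold remaining
  by_cases h : c = a + 1
  · subst h
    rw [if_pos (by omega), if_neg (by omega)]
    simp [entry]
  · split_ifs with h1 h2 h2
    · rfl
    · omega
    · omega
    · rcases Nat.eq_zero_or_pos c with rfl | hc
      · simp [entry]
      · obtain ⟨d, rfl⟩ : ∃ d, c = a + 1 + (d + 1) := ⟨c - a - 2, by omega⟩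
        rw [show a + 1 + (d + 1) - (a + 1) = d + 1 by omega,
          show a + 1 + (d + 1) - a = d + 1 + 1 by omega, entry_cons_succ _ _ _ (by omega)]

/-- Deleting the irrelevant letter `a + 1 + j` closes the gap that it leaves. -/
theorem remaining_cons_skip (r a x : ℕ) (L : List ℕ) {j : ℕ} (hj : 1 ≤ j) (c : ℕ) :
    remaining r a (x :: L) (skip (a + 1 + j) c) = remaining r a (x :: L.eraseIdx (j - 1)) c := by
  unfold skip
  rcases le_or_gt c a with hca | hca
  · rw [if_pos (by omega)]
    unfold remaining
    have : c - a = 0 := by omega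
    rw [this, entry_zero, entry_zero]
  · obtain ⟨i, rfl⟩ : ∃ i, c = a + (i + 1) := ⟨c - a - 1, by omega⟩
    rw [remaining_add _ _ _ (by omega)]
    rcases Nat.eq_zero_or_pos i with rfl | hi
    · rw [if_pos (by omega), remaining_add _ _ _ (by omega), entry_cons_one, entry_cons_one]
    · rw [entry_cons_eraseIdx _ _ hj (by omega)]
      by_cases hij : i + 1 ≤ j
      · rw [if_pos (by omega), if_pos hij, remaining_add _ _ _ (by omega),
          entry_cons_succ _ _ _ hi]
        rfl
      · rw [if_neg (by omega), if_neg hij, add_assoc a, remaining_add _ _ _ (by omega),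
          entry_cons_succ _ _ _ (by omega)]

theorem remove_zip (x j : ℕ) (σ : State) : (remove x σ j).minima.zip (remove x σ j).seqs =
    relabel (fun c => if c < j then c + 1 else c) (σ.minima.zip σ.seqs) := by
  simp only [remove, zip_map, relabel]
  rfl

/-- Removing the index `j` lowers `a` by one; thus the letters below the removed one keep their
value, and those above are lowered by one. -/
theorem shift_succ_eq_relabel (x a : ℕ) {j : ℕ} {σ : State} (hM : j ∉ σ.minima)
    (hS : ∀ s ∈ σ.seqs, j ∉ s) :
    shift (a + 1) σ = relabel (skip (a + 1 + j)) (shift a (remove x σ j)) := by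
  have key : ∀ c, c ≠ j → a + 1 + c = skip (a + 1 + j) (a + (if c < j then c + 1 else c)) := by
    intro c hc
    unfold skip
    split_ifs <;> omega
  unfold shift
  rw [remove_zip]
  unfold relabel
  rw [map_map, map_map]
  apply map_congr_left
  intro y hy
  refine Prod.ext (key _ ?_) ?_
  · exact fun e => hM (e ▸ fst_mem_of_mem_zip hy)
  · simp only [Function.comp_apply, map_map]
    apply map_congr_left
    intro c hc
    exact key c fun e => hS _ (snd_mem_of_mem_zip hy) (e ▸ hc)

theorem comp_remove (r k a x : ℕ) {j : ℕ} {σ : State} (hj : j ∈ irrelevant σ) :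
    (Comp k (remaining r a (x :: σ.counts)) (shift (a + 1) σ)).ncard =
      (Comp k (remaining r a (remove x σ j).counts) (shift a (remove x σ j))).ncard := by
  obtain ⟨⟨h1, -⟩, h0, hM, hS⟩ := mem_irrelevant.1 hj
  rw [shift_succ_eq_relabel x a hM hS]
  refine comp_relabel (strictMono_skip _) _ (remaining_cons_skip r a x σ.counts h1) fun c hc => ?_
  have : c = a + 1 + j := by
    by_contra hne
    exact hc (mem_range_skip hne)
  rw [this, add_assoc, remaining_add _ _ _ (by omega), add_comm, entry_cons_succ _ _ _ h1, h0]

theorem relabel_zero_add (P : List (ℕ × List ℕ)) : relabel (fun c => 0 + c) P = P := by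
  simp [relabel]

theorem remaining_zero (r : ℕ) (L : List ℕ) (c : ℕ) : remaining r 0 L c = entry L c := by
  unfold remaining
  rw [if_neg (by omega), Nat.sub_zero]

theorem comp_succ_remove (r k a : ℕ) {j : ℕ} {σ : State} (hj : j ∈ irrelevant σ) :
    (Comp k (remaining r (a + 1) σ.counts) (shift (a + 1) σ)).ncard =
      (Comp k (remaining r a (remove r σ j).counts) (shift a (remove r σ j))).ncard := by
  rw [← comp_remove r k a r hj]
  congr 2
  exact funext (remaining_succ r a σ.counts)

/-- If no unlisted letter is left, a letter without copies takes the place of the removed one. -/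
theorem comp_zero_remove (r k : ℕ) {j : ℕ} {σ : State} (hj : j ∈ irrelevant σ) :
    (Comp k (remaining r 0 σ.counts) (shift 0 σ)).ncard =
      (Comp k (remaining r 0 (remove 0 σ j).counts) (shift 0 (remove 0 σ j))).ncard := by
  rw [← comp_remove r k 0 0 hj]
  have h0 : shift 0 σ = σ.minima.zip σ.seqs := relabel_zero_add _
  rw [h0]
  refine (comp_relabel (strictMono_const_add 1) _ (fun c => ?_) fun c hc => ?_).symm
  · rw [remaining_zero, remaining_zero]
    rcases Nat.eq_zero_or_pos c with rfl | hc
    · rw [entry_cons_one, entry_zero]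
    · rw [add_comm, entry_cons_succ _ _ _ hc]
  · have : c = 0 := by
      by_contra hne
      exact hc ⟨c - 1, by simp only; omega⟩
    rw [this, remaining_zero, entry_zero]

theorem length_remove {x j : ℕ} {σ : State} (hj : j ∈ irrelevant σ) :
    (remove x σ j).counts.length = σ.counts.length := by
  obtain ⟨⟨h1, h2⟩, -⟩ := mem_irrelevant.1 hj
  simp only [remove, length_cons]
  rw [length_eraseIdx_of_lt (by omega)]
  omega

theorem ValidState.remove {r k x j : ℕ} {σ : State} (h : ValidState r k σ) (hx : x ≤ r)
    (hj : j ∈ irrelevant σ) : ValidState r k (remove x σ j) := by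
  obtain ⟨⟨h1, h2⟩, h0, hM, hS⟩ := mem_irrelevant.1 hj
  have hrange : ∀ c, 1 ≤ c ∧ c ≤ σ.counts.length → c ≠ j →
      1 ≤ (if c < j then c + 1 else c) ∧ (if c < j then c + 1 else c) ≤ σ.counts.length := by
    intro c hc hcj
    split_ifs <;> omega
  refine ⟨by simpa [WordRecurrence.remove] using h.length_eq, ?_, ?_, ?_⟩
  · rw [length_remove hj]
    intro m hm
    obtain ⟨m, hm', rfl⟩ := mem_map.1 hm
    exact hrange m (h.minima_mem m hm') fun e => hM (e ▸ hm')
  · rw [length_remove hj]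
    intro s hs c hc
    obtain ⟨s, hs', rfl⟩ := mem_map.1 hs
    obtain ⟨c, hc', rfl⟩ := mem_map.1 hc
    exact hrange c (h.seqs_mem s hs' c hc') fun e => hS s hs' (e ▸ hc')
  · have hv := h.valid_shift 1
    rw [shift_succ_eq_relabel x 0 hM hS] at hv
    have h0 : shift 0 (WordRecurrence.remove x σ j) = _ := relabel_zero_add _
    rw [h0] at hv
    refine hv.of_relabel (strictMono_skip _) fun c => ?_
    rw [remaining_succ, remaining_cons_skip _ _ _ _ h1, remaining_zero]
    rcases Nat.eq_zero_or_pos c with rfl | hc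
    · simp [entry_zero]
    · obtain ⟨c, rfl⟩ : ∃ d, c = d + 1 := ⟨c - 1, by omega⟩
      rw [entry_succ, entry_succ]
      rcases c with _ | c
      · simpa [WordRecurrence.remove] using hx
      · simp [WordRecurrence.remove]

theorem sum_remove {x j : ℕ} {σ : State} (hj : j ∈ irrelevant σ) :
    (remove x σ j).counts.sum = x + σ.counts.sum := by
  obtain ⟨⟨h1, h2⟩, h0, -⟩ := mem_irrelevant.1 hj
  have h3 : j - 1 < σ.counts.length := by omega
  have h4 := CommMonoid.add_sum_eraseIdx h3
  have h5 : σ.counts[j - 1] = 0 := by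
    rw [← getD_eq_getElem _ 0 h3, ← entry_succ, Nat.sub_add_cancel h1, h0]
  rw [h5, zero_add] at h4
  simp [remove, h4]

/-- Larger irrelevant letters keep their position. -/
theorem mem_irrelevant_remove_of_lt {x j j' : ℕ} {σ : State} (hj : j ∈ irrelevant σ)
    (hlt : j < j') : j' ∈ irrelevant (remove x σ j) ↔ j' ∈ irrelevant σ := by
  obtain ⟨⟨h1, h2⟩, h0, hM, hS⟩ := mem_irrelevant.1 hj
  have key : ∀ s : List ℕ, j ∉ s →
      (j' ∈ s.map (fun c => if c < j then c + 1 else c) ↔ j' ∈ s) := by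
    intro s hs
    rw [mem_map]
    constructor
    · rintro ⟨c, hc, he⟩
      have : c ≠ j := fun e => hs (e ▸ hc)
      split_ifs at he
      · omega
      · exact he ▸ hc
    · intro h
      exact ⟨j', h, if_neg (by omega)⟩
  rw [mem_irrelevant, mem_irrelevant, length_remove hj]
  refine and_congr_right fun _ => and_congr ?_ (and_congr ?_ ?_)
  · simp only [remove]
    rw [entry_cons_eraseIdx _ _ h1 (by omega), if_neg (by omega)]
  · exact not_congr (key _ hM)
  · simp only [remove, forall_mem_map]
    exact forall₂_congr fun s hs => not_congr (key s (hS s hs))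

/-- No letter below the least irrelevant one becomes irrelevant. -/
theorem not_mem_irrelevant_remove {x j j' : ℕ} {σ : State} (hx : x ≠ 0) (hj : j ∈ irrelevant σ)
    (hmin : ∀ i ∈ irrelevant σ, j ≤ i) (hle : j' ≤ j) : j' ∉ irrelevant (remove x σ j) := by
  obtain ⟨⟨h1, h2⟩, h0, hM, hS⟩ := mem_irrelevant.1 hj
  intro hj'
  obtain ⟨⟨h3, h4⟩, h5, h6, h7⟩ := mem_irrelevant.1 hj'
  simp only [remove] at h5 h6 h7
  rcases (show j' = 1 ∨ 2 ≤ j' by omega) with rfl | h8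
  · rw [entry_cons_one] at h5
    exact hx h5
  · rw [entry_cons_eraseIdx _ _ h1 h8, if_pos hle] at h5
    have hmap : ∀ s : List ℕ, j' ∉ s.map (fun c => if c < j then c + 1 else c) → j' - 1 ∉ s := by
      intro s hs hmem
      refine hs (mem_map.2 ⟨j' - 1, hmem, ?_⟩)
      rw [if_pos (by omega)]
      omega
    have hmem : j' - 1 ∈ irrelevant σ :=
      mem_irrelevant.2 ⟨by omega, h5, hmap _ h6, fun s hs => hmap s (h7 _ (mem_map_of_mem hs))⟩
    have := hmin _ hmem
    omega

/-- The letters of `J` are removed in turn. Each is replaced by an unlisted letter as long as there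
is one, that is, `a` times, and then by a letter without copies. -/
def removeAll (r : ℕ) : ℕ → List ℕ → State → State
  | _, [], σ => σ
  | 0, j :: J, σ => removeAll r 0 J (remove 0 σ j)
  | a + 1, j :: J, σ => removeAll r a J (remove r σ j)

/-- Removing irrelevant letters changes neither the number of remaining letters nor the number of
completions, and no new letter becomes irrelevant as long as `a` suffices. -/
theorem removeAll_spec {r k : ℕ} (hr : 1 ≤ r) (J : List ℕ) (a : ℕ) (σ : State)
    (hσ : ValidState r k σ) (hJ : J.Pairwise (· < ·)) (hirr : ∀ j ∈ J, j ∈ irrelevant σ) :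
    ValidState r k (removeAll r a J σ) ∧ (removeAll r a J σ).counts.length = σ.counts.length ∧
    total r (a - J.length) (removeAll r a J σ) = total r a σ ∧
    (Comp k (remaining r (a - J.length) (removeAll r a J σ).counts)
      (shift (a - J.length) (removeAll r a J σ))).ncard =
        (Comp k (remaining r a σ.counts) (shift a σ)).ncard ∧
    (J.length ≤ a → (∀ j ∈ irrelevant σ, j ∈ J) → irrelevant (removeAll r a J σ) = []) := by
  induction J generalizing a σ with
  | nil =>
    cases a <;> exact ⟨hσ, rfl, rfl, rfl, fun _ h =>
      eq_nil_iff_forall_not_mem.2 fun j hj => by simpa using h j hj⟩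
  | cons j J ih =>
    rw [pairwise_cons] at hJ
    have hj := hirr j (by simp)
    have htail : ∀ x, ∀ i ∈ J, i ∈ irrelevant (remove x σ j) := fun x i hi =>
      (mem_irrelevant_remove_of_lt hj (hJ.1 i hi)).2 (hirr i (by simp [hi]))
    cases a with
    | zero =>
      obtain ⟨h1, h2, h3, h4, -⟩ :=
        ih 0 (remove 0 σ j) (hσ.remove (Nat.zero_le r) hj) hJ.2 (htail 0)
      rw [Nat.zero_sub] at h3 h4
      rw [Nat.zero_sub]
      refine ⟨h1, h2.trans (length_remove hj), h3.trans ?_,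
        h4.trans (comp_zero_remove r k hj).symm, fun h => by simp at h⟩
      simp only [total, sum_remove hj, zero_add]
    | succ a =>
      obtain ⟨h1, h2, h3, h4, h5⟩ := ih a (remove r σ j) (hσ.remove le_rfl hj) hJ.2 (htail r)
      rw [length_cons, Nat.add_sub_add_right]
      refine ⟨h1, h2.trans (length_remove hj), h3.trans ?_,
        h4.trans (comp_succ_remove r k a hj).symm, fun h6 h7 => h5 (by omega) fun i hi => ?_⟩
      · simp only [total, sum_remove hj]
        ring
      · rcases lt_or_ge j i with hij | hij
        · rw [mem_irrelevant_remove_of_lt hj hij] at hi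
          exact (mem_cons.1 (h7 i hi)).resolve_left (by omega)
        · refine absurd hi (not_mem_irrelevant_remove (by omega) hj (fun i' hi' => ?_) hij)
          rcases mem_cons.1 (h7 i' hi') with rfl | h8
          · exact le_rfl
          · exact (hJ.1 i' h8).le

/-- The prepended entries are not affected by later removals, whatever their value `x`. -/
theorem exists_foldl_remove (J : List ℕ) (s : ℕ) (hJ : J.Pairwise (· < ·))
    (hs : ∀ j ∈ J, s < j) (M : List ℕ) (S : List (List ℕ)) (X : List ℕ) : ∃ M' S' X', ∀ x,
      J.foldl (remove x) ⟨M, S, replicate s x ++ X⟩ =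
        ⟨M', S', replicate (s + J.length) x ++ X'⟩ := by
  induction J generalizing s M S X with
  | nil => exact ⟨M, S, X, fun x => rfl⟩
  | cons j J ih =>
    rw [pairwise_cons] at hJ
    have hsj := hs j (by simp)
    obtain ⟨M', S', X', h⟩ := ih (s + 1) hJ.2 (fun i hi => by have := hJ.1 i hi; omega)
      (M.map (fun c => if c < j then c + 1 else c))
      (S.map (List.map (fun c => if c < j then c + 1 else c))) (X.eraseIdx (j - 1 - s))
    refine ⟨M', S', X', fun x => ?_⟩
    rw [foldl_cons, length_cons, show s + (J.length + 1) = s + 1 + J.length by omega, ← h x]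
    congr 1
    simp only [remove, replicate_succ, cons_append]
    rw [eraseIdx_append_of_length_le (by simp; omega), length_replicate]

theorem clearFirst_replicate_append {r : ℕ} (hr : 1 ≤ r) (d : ℕ) (X : List ℕ) :
    clearFirst d (replicate d r ++ X) = replicate d 0 ++ X := by
  obtain ⟨r, rfl⟩ : ∃ s, r = s + 1 := ⟨r - 1, by omega⟩
  induction d with
  | zero => simp [clearFirst]
  | succ d ih => simp [replicate_succ, clearFirst, ih]

theorem removeAll_zero (r : ℕ) (J : List ℕ) (σ : State) :
    removeAll r 0 J σ = J.foldl (remove 0) σ := by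
  induction J generalizing σ with
  | nil => rfl
  | cons j J ih => exact ih _

/-- Replacing the letters that exceed the supply `a` by letters without copies has the same result
as clearing the first entries afterwards. -/
theorem removeAll_eq {r : ℕ} (hr : 1 ≤ r) (J : List ℕ) (hJ : J.Pairwise (· < ·))
    (h0 : ∀ j ∈ J, 0 < j) (a : ℕ) (σ : State) : removeAll r a J σ =
      { J.foldl (remove r) σ with
        counts := clearFirst (J.length - a) (J.foldl (remove r) σ).counts } := by
  induction J generalizing a σ with
  | nil => cases a <;> simp [removeAll, clearFirst]
  | cons j J ih =>
    cases a with
    | zero =>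
      obtain ⟨M, S, L⟩ := σ
      obtain ⟨M', S', X', h⟩ := exists_foldl_remove (j :: J) 0 hJ h0 M S L
      simp only [replicate_zero, nil_append, zero_add] at h
      rw [removeAll_zero, h, h, Nat.sub_zero, clearFirst_replicate_append hr]
    | succ a =>
      rw [length_cons, Nat.add_sub_add_right]
      exact ih (pairwise_cons.1 hJ).2 (fun i hi => h0 i (by simp [hi])) a _

theorem irrelevant_pairwise (σ : State) : (irrelevant σ).Pairwise (· < ·) :=
  Pairwise.filter _ pairwise_lt_range'

theorem next_eq_removeAll {r : ℕ} (hr : 1 ≤ r) (a : ℕ) (σ : State) (i : ℕ) :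
    next r a σ i = removeAll r a (irrelevant (addLetter σ i)) (addLetter σ i) := by
  rw [removeAll_eq hr _ (irrelevant_pairwise _) fun j hj => (mem_irrelevant.1 hj).1.1]
  rfl

/-! ### The recurrence -/

theorem sum_modify_pred (L : List ℕ) (i : ℕ) (h : L.getD i 0 ≠ 0) :
    (L.modify i (fun l => l - 1)).sum + 1 = L.sum := by
  induction L generalizing i with
  | nil => simp at h
  | cons x L ih =>
    cases i with
    | zero =>
      simp only [getD_cons_zero] at h
      simp only [modify_zero_cons, sum_cons]
      omega
    | succ i =>
      simp only [getD_cons_succ] at h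
      have := ih i h
      simp only [modify_succ_cons, sum_cons]
      omega

theorem ValidState.counts_addLetter {r k : ℕ} {σ : State} (h : ValidState r k σ) (i : ℕ) :
    (WordRecurrence.addLetter σ i).counts = reduce σ.counts i := by
  rw [addLetter_eq h.length_eq h.valid.nested]

theorem ValidState.total_addLetter {r k a i : ℕ} {σ : State} (h : ValidState r k σ)
    (hi : entry σ.counts i ≠ 0) :
    total r a (WordRecurrence.addLetter σ i) + 1 = total r a σ := by
  obtain ⟨j, rfl⟩ : ∃ j, i = j + 1 := ⟨i - 1, by have := one_le_of_entry_ne_zero hi; omega⟩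
  rw [entry_succ] at hi
  unfold total
  rw [h.counts_addLetter, add_assoc]
  congr 1
  exact sum_modify_pred _ _ hi

theorem remaining_eq_zero_iff {r a : ℕ} (hr : 1 ≤ r) (L : List ℕ) :
    (∀ c, remaining r a L c = 0) ↔ r * a + L.sum = 0 := by
  constructor
  · intro h
    have ha : a = 0 := by
      by_contra ha
      have := h 1
      rw [remaining, if_pos (by omega)] at this
      omega
    subst ha
    rw [mul_zero, zero_add, sum_eq_zero_iff]
    intro l hl
    obtain ⟨i, hi, rfl⟩ := exists_getD_of_mem hl
    have := h (i + 1)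
    rwa [remaining_zero, entry_succ] at this
  · intro h c
    have ha : a = 0 := by
      by_contra ha
      have := Nat.mul_pos hr (Nat.pos_of_ne_zero ha)
      omega
    subst ha
    rw [mul_zero, zero_add, sum_eq_zero_iff] at h
    rw [remaining_zero]
    by_contra hc
    obtain ⟨i, rfl⟩ : ∃ i, c = i + 1 := ⟨c - 1, by have := one_le_of_entry_ne_zero hc; omega⟩
    have h2 := le_length_of_entry_ne_zero hc
    rw [entry_succ] at hc
    exact hc (h _ (getD_mem (by omega)))

theorem IsCanonical.validState {r k a : ℕ} {σ : State} (h : IsCanonical r k a σ) :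
    ValidState r k σ := exists_isPartialWord_iff.1 h.2.2

theorem isCanonical_iff {r k a : ℕ} {σ : State} : IsCanonical r k a σ ↔
    σ.counts.length = tlen r k ∧ (0 < a → irrelevant σ = []) ∧ ValidState r k σ := by
  rw [IsCanonical, exists_isPartialWord_iff]

theorem avoids_nil (k : ℕ) : Avoids k [] :=
  (avoids_iff k []).2 fun _ _ hu => by simp at hu

theorem A_eq_one {r k a : ℕ} (hr : 1 ≤ r) {σ : State} (h : ValidState r k σ)
    (h0 : total r a σ = 0) : A r k a σ = 1 := by
  have hz := (remaining_eq_zero_iff hr σ.counts).2 h0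
  rw [A_eq h, Set.ncard_eq_one]
  refine ⟨[], Set.Subset.antisymm (fun z hzc => ?_) (Set.singleton_subset_iff.2 ?_)⟩
  · rw [Set.mem_singleton_iff, eq_nil_iff_forall_not_mem]
    intro c
    rw [← count_eq_zero, hzc.1, hz]
  · refine ⟨fun c => by simp [hz], avoids_nil k, fun x hx => ?_⟩
    simpa using (h.valid_shift a).good x hx

theorem next_spec {r k a i : ℕ} (hr : 1 ≤ r) (hk : 3 ≤ k) {σ : State}
    (hσ : IsCanonical r k a σ) (hi : i ∈ choices k σ) :
    IsCanonical r k (a - lost σ i) (next r a σ i) ∧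
      total r (a - lost σ i) (next r a σ i) + 1 = total r a σ ∧
      A r k (a - lost σ i) (next r a σ i) =
        (Comp k (remaining r a (addLetter σ i).counts) (shift a (addLetter σ i))).ncard := by
  have h := hσ.validState
  obtain ⟨h1, h2⟩ := mem_choices hi
  have hadd := h.addLetter hk h1 h2
  obtain ⟨h3, h4, h5, h6, h7⟩ := removeAll_spec hr _ a _ hadd
    (irrelevant_pairwise (addLetter σ i)) fun _ hj => hj
  rw [← next_eq_removeAll hr] at h3 h4 h5 h6 h7
  refine ⟨isCanonical_iff.2 ⟨?_, fun ha => h7 ?_ fun _ hj => hj, h3⟩, ?_, ?_⟩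
  · rw [h4, h.counts_addLetter, length_reduce, hσ.1]
  · unfold lost at ha
    omega
  · rw [← h.total_addLetter h1]
    exact congrArg (· + 1) h5
  · rw [A_eq h3]
    exact h6

theorem A_eq_sum {r k a : ℕ} (hr : 1 ≤ r) (hk : 3 ≤ k) {σ : State} (hσ : IsCanonical r k a σ)
    (h0 : 0 < total r a σ) :
    A r k a σ = ∑ i ∈ choices k σ, A r k (a - lost σ i) (next r a σ i) := by
  have h := hσ.validState
  rw [A_eq h, Finset.sum_congr rfl fun i hi => (next_spec hr hk hσ hi).2.2]
  refine ncard_eq_sum_cons (finite_comp _ _ _) (fun hnil => h0.ne' ?_)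
    (fun c z hz => exists_choice_of_cons_mem_comp hk h hσ.1 hσ.2.1 hz)
    fun i hi z => cons_mem_comp_iff h (mem_choices hi).1 (mem_choices hi).2 z
  exact (remaining_eq_zero_iff hr σ.counts).1 fun c => (hnil.1 c).symm

/-! ### Words as completions of the empty word -/

theorem entry_replicate (m x c : ℕ) :
    entry (replicate m x) c = if 1 ≤ c ∧ c ≤ m then x else 0 := by
  rw [← append_nil (replicate m x), entry_replicate_append, remaining]
  simp [entry]

/-- The padding by letters without copies shifts the letters of the words by `t - n`. -/
theorem remaining_initial (r k n c : ℕ) :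
    remaining r (n - tlen r k) (initial r k n).counts (tlen r k - n + c) =
      if 1 ≤ c ∧ c ≤ n then r else 0 := by
  simp only [initial, remaining, entry_replicate_append, entry_replicate]
  generalize tlen r k = t
  split_ifs <;> omega

theorem length_initial (r k n : ℕ) : (initial r k n).counts.length = tlen r k := by
  simp only [initial, length_append, length_replicate]
  omega

theorem entry_initial_le (r k n c : ℕ) : entry (initial r k n).counts c ≤ r := by
  simp only [initial, remaining, entry_replicate_append, entry_replicate]
  split_ifs <;> omega

theorem initial_of_le {r k n : ℕ} (h : tlen r k ≤ n) :
    initial r k n = ⟨[], [], replicate (tlen r k) r⟩ := by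
  have : tlen r k - n = 0 := by omega
  simp [initial, this]

theorem isCanonical_initial {r k : ℕ} (hr : 1 ≤ r) (a n : ℕ) (ha : 0 < a → tlen r k ≤ n) :
    IsCanonical r k a (initial r k n) := by
  refine isCanonical_iff.2 ⟨length_initial r k n, fun h0 => ?_, rfl, by simp [initial],
    by simp [initial], nested_nil, ?_, by simp [initial], by simp [initial]⟩
  · rw [initial_of_le (ha h0), eq_nil_iff_forall_not_mem]
    intro j hj
    obtain ⟨h1, h2, -⟩ := mem_irrelevant.1 hj
    rw [length_replicate] at h1
    rw [entry_replicate, if_pos h1] at h2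
    omega
  · intro c s hs
    have : s = [] := by simpa [initial] using hs
    subst this
    simpa [initial] using entry_initial_le r k n c

theorem numWords_eq {r k : ℕ} (hr : 1 ≤ r) (n : ℕ) :
    numWords r k n = A r k (n - tlen r k) (initial r k n) := by
  have hcan := isCanonical_initial (k := k) hr (n - tlen r k) n (by omega)
  rw [A_eq hcan.validState]
  have h0 : shift (n - tlen r k) (initial r k n) =
      relabel (fun c => tlen r k - n + c) [] := rfl
  rw [h0, comp_relabel (strictMono_const_add _) _ (remaining_initial r k n)]
  · simp [numWords, Comp]
  · intro c hc
    have hlt : c < tlen r k - n := by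
      by_contra hge
      exact hc ⟨c - (tlen r k - n), by simp only; omega⟩
    simp only [initial, remaining, entry_replicate_append, entry_replicate]
    split_ifs <;> omega

/-! ### The linear system -/

theorem length_irrelevant_le (σ : State) : (irrelevant σ).length ≤ σ.counts.length :=
  (length_filter_le _ _).trans (by simp)

theorem next_of_lost_le {r a i : ℕ} {σ : State} (h : lost σ i ≤ a) :
    next r a σ i = successor r σ i := by
  unfold next
  rw [Nat.sub_eq_zero_of_le h]
  simp [clearFirst]

theorem lost_le {r k i : ℕ} {σ : State} (h : ValidState r k σ) : lost σ i ≤ σ.counts.length := by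
  refine (length_irrelevant_le _).trans ?_
  rw [h.counts_addLetter, length_reduce]

/-- For positive `a`, being canonical depends on the state only. -/
theorem isCanonical_of_pos {r k a b : ℕ} {σ : State} (h : IsCanonical r k a σ) (ha : 0 < a) :
    IsCanonical r k b σ := by
  rw [isCanonical_iff] at h ⊢
  exact ⟨h.1, fun _ => h.2.1 ha, h.2.2⟩

theorem sum_counts_le {r k : ℕ} {σ : State} (h : ValidState r k σ) :
    σ.counts.sum ≤ r * σ.counts.length := by
  have := sum_le_card_nsmul σ.counts r h.counts_le
  rwa [smul_eq_mul, mul_comm] at this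

theorem byTotal_eq {r k : ℕ} (hr : 1 ≤ r) (σ : State) (a : ℕ) :
    byTotal r k σ (r * a + σ.counts.sum) = A r k a σ := by
  unfold byTotal
  rw [if_pos ⟨by omega, by simp⟩, Nat.add_sub_cancel, Nat.mul_div_cancel_left _ hr]

theorem byTotal_eq_zero {r k : ℕ} {σ : State} {N : ℕ} (h : ¬ ∃ a, N = r * a + σ.counts.sum) :
    byTotal r k σ N = 0 := by
  unfold byTotal
  rw [if_neg]
  rintro ⟨h1, a, ha⟩
  exact h ⟨a, by omega⟩

theorem successor_spec {r k a i : ℕ} (hr : 1 ≤ r) (hk : 3 ≤ k) {σ : State}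
    (hσ : IsCanonical r k a σ) (ha : 0 < a) (hi : i ∈ choices k σ) :
    IsCanonical r k 1 (successor r σ i) ∧
      (successor r σ i).counts.sum + 1 = σ.counts.sum + r * lost σ i := by
  have hσ' := isCanonical_of_pos (b := lost σ i + 1) hσ ha
  obtain ⟨h1, h2, -⟩ := next_spec hr hk hσ' hi
  rw [next_of_lost_le (by omega), Nat.add_sub_cancel_left] at h1 h2
  refine ⟨h1, ?_⟩
  unfold total at h2
  rw [mul_add] at h2
  omega

/-- The recurrence in terms of the number of remaining letters. If that number is `2rt` or more,
then `a > t`, so that there are enough unlisted letters to replace all irrelevant ones. -/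
theorem byTotal_succ {r k a N : ℕ} (hr : 1 ≤ r) (hk : 3 ≤ k) {σ : State}
    (hσ : IsCanonical r k a σ) (ha : 0 < a) (hN : 2 * r * tlen r k ≤ N) :
    byTotal r k σ (N + 1) = ∑ i ∈ choices k σ, byTotal r k (successor r σ i) N := by
  have hv := hσ.validState
  have hsum := sum_counts_le hv
  rw [hσ.1, mul_assoc] at *
  by_cases hb : ∃ b, N + 1 = r * b + σ.counts.sum
  · obtain ⟨b, hb⟩ := hb
    have htb : tlen r k < b := by
      refine Nat.lt_of_mul_lt_mul_left (a := r) ?_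
      omega
    have hσ' := isCanonical_of_pos (b := b) hσ ha
    have h0 : 0 < total r b σ := by
      unfold total
      omega
    rw [hb, byTotal_eq hr, A_eq_sum hr hk hσ' h0]
    refine Finset.sum_congr rfl fun i hi => ?_
    have hlost : lost σ i ≤ b := ((lost_le hv).trans hσ.1.le).trans htb.le
    obtain ⟨-, h2⟩ := successor_spec hr hk hσ ha hi
    rw [next_of_lost_le hlost, ← byTotal_eq hr]
    congr 1
    have h3 : r * (b - lost σ i) + r * lost σ i = r * b := by
      rw [← mul_add, Nat.sub_add_cancel hlost]
    omega
  · rw [byTotal_eq_zero hb, eq_comm]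
    refine Finset.sum_eq_zero fun i hi => byTotal_eq_zero ?_
    rintro ⟨b, hb'⟩
    obtain ⟨-, h2⟩ := successor_spec hr hk hσ ha hi
    exact hb ⟨b + lost σ i, by rw [mul_add]; omega⟩

theorem finite_canonical {r k : ℕ} (hk : 3 ≤ k) : {σ : State | ∃ a, IsCanonical r k a σ}.Finite :=
  (finite_validState hk (tlen r k)).subset fun _ ⟨_, h⟩ => ⟨h.1, h.validState⟩

theorem exists_linear_system {r k : ℕ} (hr : 1 ≤ r) (hk : 3 ≤ k) :
    ∃ (d : ℕ) (state : Fin d → State) (i₀ : Fin d), Function.Injective state ∧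
      Set.range state = {σ : State | ∃ a, 0 < a ∧ IsCanonical r k a σ} ∧
      (∀ N ≥ 2 * r * tlen r k, ∀ i : Fin d,
        byTotal r k (state i) (N + 1) =
          ∑ j : Fin d, ((choices k (state i)).filter
            (fun c => successor r (state i) c = state j)).card * byTotal r k (state j) N) ∧
      ∀ n ≥ tlen r k, numWords r k n = byTotal r k (state i₀) (r * n) := by
  have hfin : {σ : State | ∃ a, 0 < a ∧ IsCanonical r k a σ}.Finite :=
    (finite_canonical hk).subset fun σ ⟨a, _, h⟩ => ⟨a, h⟩
  obtain ⟨d, state, hinj, hrange⟩ : ∃ (d : ℕ) (state : Fin d → State), Function.Injective state ∧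
      Set.range state = {σ : State | ∃ a, 0 < a ∧ IsCanonical r k a σ} := by
    refine ⟨_, fun i => (hfin.toFinset.equivFin.symm i : State),
      Subtype.val_injective.comp (Equiv.injective _), ?_⟩
    rw [Set.range_comp' Subtype.val, Equiv.range_eq_univ, Set.image_univ]
    ext σ
    simp
  have hmem : ∀ i, ∃ a, 0 < a ∧ IsCanonical r k a (state i) := fun i => by
    have := Set.mem_range_self (f := state) i
    rwa [hrange] at this
  have hinit : initial r k (tlen r k) ∈ Set.range state := by
    rw [hrange]
    exact ⟨1, one_pos, isCanonical_initial hr 1 _ fun _ => le_rfl⟩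
  obtain ⟨i₀, hi₀⟩ := hinit
  refine ⟨d, state, i₀, hinj, hrange, fun N hN i => ?_, fun n hn => ?_⟩
  · obtain ⟨a, ha, hcan⟩ := hmem i
    rw [byTotal_succ hr hk hcan ha hN]
    have h1 : ∀ c ∈ choices k (state i), byTotal r k (successor r (state i) c) N =
        ∑ j, if successor r (state i) c = state j then byTotal r k (state j) N else 0 := by
      intro c hc
      have hc' : successor r (state i) c ∈ Set.range state := by
        rw [hrange]
        exact ⟨1, one_pos, (successor_spec hr hk hcan ha hc).1⟩
      obtain ⟨j, hj⟩ := hc'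
      rw [Finset.sum_eq_single j]
      · rw [if_pos hj.symm, hj]
      · intro j' _ hj'
        rw [if_neg]
        rw [← hj]
        exact fun e => hj' (hinj e).symm
      · simp
    rw [Finset.sum_congr rfl h1, Finset.sum_comm]
    refine Finset.sum_congr rfl fun j _ => ?_
    rw [← Finset.sum_filter, Finset.sum_const, smul_eq_mul]
  · rw [numWords_eq hr, hi₀, initial_of_le hn, initial_of_le le_rfl, ← byTotal_eq hr]
    congr 1
    simp only [sum_replicate, smul_eq_mul]
    rw [mul_comm (tlen r k), ← mul_add, Nat.sub_add_cancel hn]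

/-! ### Rationality of the generating function -/

/-- A linear recurrence with characteristic polynomial `p` that holds from some point on makes the
product of the generating function and the reversed polynomial a polynomial. -/
theorem exists_rational_of_recurrence {W : ℕ → ℚ} {p : Polynomial ℚ} (hp : p.Monic) (n₀ : ℕ)
    (h : ∀ n ≥ n₀, ∑ m ∈ Finset.range (p.natDegree + 1), p.coeff m * W (n + m) = 0) :
    ∃ P Q : Polynomial ℚ, Q.coeff 0 ≠ 0 ∧
      (Q : PowerSeries ℚ) * PowerSeries.mk W = (P : PowerSeries ℚ) := by
  set D := p.natDegree with hD
  refine ⟨PowerSeries.trunc (n₀ + D) ((p.reverse : PowerSeries ℚ) * PowerSeries.mk W), p.reverse,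
    ?_, ?_⟩
  · rw [Polynomial.coeff_zero_reverse, hp.leadingCoeff]
    exact one_ne_zero
  · ext n
    rw [Polynomial.coeff_coe, PowerSeries.coeff_trunc]
    split_ifs with hn
    · rfl
    · obtain ⟨l, rfl⟩ : ∃ l, n = l + D := ⟨n - D, by omega⟩
      rw [PowerSeries.coeff_mul, Finset.Nat.sum_antidiagonal_eq_sum_range_succ_mk,
        ← h l (by omega),
        ← Finset.sum_range_reflect (fun m => p.coeff m * W (l + m)) (D + 1)]
      symm
      refine Finset.sum_subset_zero_on_sdiff (Finset.range_mono (by omega)) (fun j hj => ?_)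
        fun j hj => ?_
      · rw [Finset.mem_sdiff, Finset.mem_range, Finset.mem_range] at hj
        simp only [Polynomial.coeff_coe]
        rw [Polynomial.coeff_eq_zero_of_natDegree_lt, zero_mul]
        exact (Polynomial.reverse_natDegree_le p).trans_lt (by omega)
      · rw [Finset.mem_range] at hj
        simp only [Polynomial.coeff_coe, PowerSeries.coeff_mk]
        rw [Polynomial.coeff_reverse, Polynomial.revAt_le (by omega)]
        congr 2; omega

/-- Every component of a sequence of vectors obtained by iterating a matrix has a rational
generating function, by the Cayley–Hamilton theorem, also along an arithmetic progression. -/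
theorem exists_rational_of_linear_system {d r n₀ : ℕ} (hr : 1 ≤ r) (C : Matrix (Fin d) (Fin d) ℚ)
    (v : ℕ → Fin d → ℚ) (hv : ∀ N ≥ n₀, v (N + 1) = C.mulVec (v N)) (i : Fin d) {W : ℕ → ℚ}
    (hW : ∀ n ≥ n₀, W n = v (r * n) i) : ∃ P Q : Polynomial ℚ, Q.coeff 0 ≠ 0 ∧
      (Q : PowerSeries ℚ) * PowerSeries.mk W = (P : PowerSeries ℚ) := by
  have hpow : ∀ m, ∀ N ≥ n₀, v (N + m) = (C ^ m).mulVec (v N) := by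
    intro m N hN
    induction m with
    | zero => simp
    | succ m ih => rw [← add_assoc, hv _ (by omega), ih, Matrix.mulVec_mulVec, pow_succ']
  refine exists_rational_of_recurrence (C ^ r).charpoly_monic n₀ fun n hn => ?_
  have hrn : n₀ ≤ r * n := hn.trans (Nat.le_mul_of_pos_left n hr)
  have hch := Matrix.aeval_self_charpoly (C ^ r)
  rw [Polynomial.aeval_eq_sum_range] at hch
  have h1 := congrFun (congrArg (fun M => Matrix.mulVec M (v (r * n))) hch) i
  simp only [Matrix.sum_mulVec, Matrix.smul_mulVec, Matrix.zero_mulVec, Pi.zero_apply,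
    Finset.sum_apply, Pi.smul_apply, smul_eq_mul, ← pow_mul] at h1
  rw [← h1]
  refine Finset.sum_congr rfl fun m _ => ?_
  rw [hW _ (by omega), mul_add, hpow _ _ hrn]

theorem exists_rational {r k : ℕ} (hr : 1 ≤ r) (hk : 3 ≤ k) :
    ∃ P Q : Polynomial ℚ, Q.coeff 0 ≠ 0 ∧
      (Q : PowerSeries ℚ) * PowerSeries.mk (fun n => (numWords r k n : ℚ)) =
        (P : PowerSeries ℚ) := by
  obtain ⟨d, state, i₀, -, -, hsys, hword⟩ := exists_linear_system hr hk
  refine exists_rational_of_linear_system (n₀ := 2 * r * tlen r k) hr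
    (fun i j => (((choices k (state i)).filter
      (fun c => successor r (state i) c = state j)).card : ℚ))
    (fun N i => (byTotal r k (state i) N : ℚ)) (fun N hN => ?_) i₀ fun n hn => ?_
  · ext i
    rw [hsys N hN i]
    push_cast
    rfl
  · rw [hword n]
    have : 1 * tlen r k ≤ 2 * r * tlen r k := Nat.mul_le_mul_right _ (by omega)
    omega

end WordRecurrence

theorem mainTheorem2 (r k : ℕ) (hr : 1 ≤ r) (hk : 3 ≤ k) :
    -- `A` is well defined
    (∀ (a : ℕ) (σ : State) (w : List ℕ), IsPartialWord r k a σ w →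
      (completions r k a σ.counts w).ncard = A r k a σ) ∧
    -- every argument other than `a` ranges over a finite set
    (∀ (a : ℕ) (σ : State) (w : List ℕ), IsPartialWord r k a σ w →
      σ.minima.length = σ.seqs.length ∧ σ.minima.length ≤ 2 * r * (k - 2) + 1 ∧
      (∀ s ∈ σ.seqs, s.length ≤ 2 * r * (k - 2)) ∧ ∀ l ∈ σ.counts, l ≤ r) ∧
    {σ : State | ∃ a, IsCanonical r k a σ}.Finite ∧
    -- the recurrence, in which the number of remaining letters drops by one
    (∀ (a : ℕ) (σ : State), IsCanonical r k a σ →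
      (total r a σ = 0 → A r k a σ = 1) ∧
      (0 < total r a σ →
        A r k a σ = ∑ i ∈ choices k σ, A r k (a - lost σ i) (next r a σ i)) ∧
      ∀ i ∈ choices k σ, IsCanonical r k (a - lost σ i) (next r a σ i) ∧
        total r (a - lost σ i) (next r a σ i) + 1 = total r a σ) ∧
    -- the number of avoiding words is a value of `A`
    (∀ n : ℕ, IsCanonical r k (n - tlen r k) (initial r k n) ∧
      numWords r k n = A r k (n - tlen r k) (initial r k n)) ∧
    -- the finite linear system with constant coefficients
    (∃ (d : ℕ) (state : Fin d → State) (i₀ : Fin d), Function.Injective state ∧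
      Set.range state = {σ : State | ∃ a, 0 < a ∧ IsCanonical r k a σ} ∧
      (∀ N ≥ 2 * r * tlen r k, ∀ i : Fin d,
        byTotal r k (state i) (N + 1) =
          ∑ j : Fin d, ((choices k (state i)).filter
            (fun c => successor r (state i) c = state j)).card * byTotal r k (state j) N) ∧
      ∀ n ≥ tlen r k, numWords r k n = byTotal r k (state i₀) (r * n)) ∧
    -- the generating function is rational
    ∃ P Q : Polynomial ℚ, Q.coeff 0 ≠ 0 ∧
      (Q : PowerSeries ℚ) * PowerSeries.mk (fun n => (numWords r k n : ℚ)) = (P : PowerSeries ℚ) := by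
  refine ⟨fun a σ w hw => ?_, fun a σ w hw => ?_, finite_canonical hk, fun a σ hσ => ?_,
    fun n => ?_, exists_linear_system hr hk, exists_rational hr hk⟩
  · rw [ncard_completions hw, A_eq hw.validState]
  · have h := hw.validState
    exact ⟨h.length_eq, h.length_minima_le hk, h.length_seq_le hk, h.counts_le⟩
  · refine ⟨A_eq_one hr hσ.validState, A_eq_sum hr hk hσ, fun i hi => ?_⟩
    obtain ⟨h1, h2, -⟩ := next_spec hr hk hσ hi
    exact ⟨h1, h2⟩
  · exact ⟨isCanonical_initial hr _ n (by omega), numWords_eq hr n⟩
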